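/- Let $0\le T<\infty$, $x_0\in\mathbb{R}^d$, $l_1,\dots,l_k\in\mathbb{Z}^d$, and let $f_1,\dots,f_k:[0,T]\times\mathbb{R}^d\to\mathbb{R}$ be continuous functions such that, for every $i$ and every $t\in[0,T]$, the function $x\mapsto f_i(t,x)$ is either a constant or a linear combination of the components of $x$ (the constant and the coefficients may depend on $t$). Let $Y_1,\dots,Y_k$ be independent Poisson processes of rate $1$, and let $X=(X(t))_{0\le t\le T}$ be an $\mathbb{R}^d$-valued stochastic process which almost surely satisfies $$X(t)=x_0+\sum_{i=1}^k l_i\,Y_i\Big(\int_0^t f_i(s,X(s))\,ds\Big)\qquad\text{for all } t\in[0,T],$$ where almost surely the rates $s\mapsto f_i(s,X(s))$ are nonnegative and integrable on $[0,T]$. Let $\bar X:[0,T]\to\mathbb{R}^d$ be the fluid model, i.e. the (deterministic) solution of $$\bar X(t)=x_0+\sum_{i=1}^k l_i\int_0^t f_i(s,\bar X(s))\,ds\qquad\text{for all } t\in[0,T].$$ Then the fluid model is exact: for every $t\in[0,T]$, $X(t)$ is integrable and $E[X(t)]=\bar X(t)$. -/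

import Mathlib

open MeasureTheory ProbabilityTheory Set
open scoped NNReal

namespace StateDependentQueue

/-- A rate one Poisson process: a counting process started at `0`, with nondecreasing and
right-continuous paths, whose increments are independent, the increment over `(s, t]` being
Poisson with mean `t - s`. -/
structure IsUnitPoissonProcess {Ω : Type*} [MeasurableSpace Ω] (μ : Measure Ω)
    (Y : ℝ≥0 → Ω → ℕ) : Prop where
  measurable : ∀ t, Measurable (Y t)
  start : ∀ᵐ ω ∂μ, Y 0 ω = 0
  paths : ∀ᵐ ω ∂μ, Monotone (fun t => Y t ω) ∧
    ∀ t, ContinuousWithinAt (fun s => Y s ω) (Ici t) t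
  indep : HasIndepIncrements Y μ
  law : ∀ s t, s ≤ t → HasLaw (fun ω => Y t ω - Y s ω) (poissonMeasure (t - s)) μ

/-- The integer vector `l ∈ ℤ^d`, seen in Euclidean space `ℝ^d`. -/
noncomputable def jump {d : ℕ} (l : Fin d → ℤ) : EuclideanSpace ℝ (Fin d) :=
  WithLp.toLp 2 (fun j => (l j : ℝ))

/-- `X` is a stochastic process on `[0, T]` that almost surely satisfies
`X(t) = x₀ + ∑ i, l i * Y i (∫ s in 0..t, f i (s, X(s)))` for all `t ∈ [0, T]`. For the right side
to make sense the rates along the path are required to be nonnegative and integrable. -/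
structure IsQueueProcess {Ω : Type*} [MeasurableSpace Ω] (μ : Measure Ω) {d k : ℕ} (T : ℝ)
    (x₀ : EuclideanSpace ℝ (Fin d)) (l : Fin k → Fin d → ℤ)
    (f : Fin k → ℝ → EuclideanSpace ℝ (Fin d) → ℝ) (Y : Fin k → ℝ≥0 → Ω → ℕ)
    (X : ℝ → Ω → EuclideanSpace ℝ (Fin d)) : Prop where
  measurable : ∀ t ∈ Icc 0 T, Measurable (X t)
  rate_nonneg : ∀ᵐ ω ∂μ, ∀ i, ∀ s ∈ Icc 0 T, 0 ≤ f i s (X s ω)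
  rate_integrable : ∀ᵐ ω ∂μ, ∀ i, IntervalIntegrable (fun s => f i s (X s ω)) volume 0 T
  equation : ∀ᵐ ω ∂μ, ∀ t ∈ Icc 0 T,
    X t ω = x₀ + ∑ i, (Y i (Real.toNNReal (∫ s in 0..t, f i s (X s ω))) ω : ℝ) • jump (l i)

/-- `x` is the (deterministic) fluid model on `[0, T]`:
`x(t) = x₀ + ∑ i, l i * ∫ s in 0..t, f i (s, x(s))` for all `t ∈ [0, T]`. -/
structure IsFluidModel {d k : ℕ} (T : ℝ)
    (x₀ : EuclideanSpace ℝ (Fin d)) (l : Fin k → Fin d → ℤ)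
    (f : Fin k → ℝ → EuclideanSpace ℝ (Fin d) → ℝ)
    (x : ℝ → EuclideanSpace ℝ (Fin d)) : Prop where
  rate_integrable : ∀ i, IntervalIntegrable (fun s => f i s (x s)) volume 0 T
  equation : ∀ t ∈ Icc 0 T,
    x t = x₀ + ∑ i, (∫ s in 0..t, f i s (x s)) • jump (l i)

/-- `g : ℝ^d → ℝ` is a constant or a linear combination of the components of its argument. -/
def IsConstOrLinear {d : ℕ} (g : EuclideanSpace ℝ (Fin d) → ℝ) : Prop :=
  (∃ c : ℝ, ∀ x, g x = c) ∨ (∃ a : Fin d → ℝ, ∀ x, g x = ∑ j, a j * x j)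

end StateDependentQueue

namespace StateDependentQueue

open Filter Topology
open scoped ENNReal


/-! Call `A i t = ∫ s in 0..t, f i s (X s)` the clock of the `i`-th Poisson process. The heart of
the matter is Wald's identity `E[Y i (A i t)] = E[A i t]`. Given it, take expectations in the
equation of `X`, exchange expectation and time integral, and use that a rate affine in the state
commutes with the expectation: the mean of `X` solves the fluid equation
(`IsQueueProcess.isFluidModel_integral`). That equation has only one solution, by Grönwall, since
the rates are Lipschitz in the state uniformly over `[0, T]` (`IsFluidModel.unique`).

Wald's identity holds because `A i t` behaves like a stopping time for `Y i` once all the other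
processes are revealed in advance: whether `A i t < u` is decided by the path of `Y i` up to `u` and
by the other paths, and this information is independent of the increments of `Y i` after `u`. To
prove this, note that the state is a function of the event counts, so the clocks solve an integral
equation driven by the counting paths (`IsClock`). Its solution is unique (`IsClock.unique`), so the
Lusin–Souslin theorem makes "the clock is below `u`" a measurable condition on the paths
(`exists_measurableSet_clock_lt`), and altering `Y i` beyond `u` does not affect a clock that ends
below `u` (`exists_measurableSet_stoppedPaths`). Optional stopping for bounded times then follows by
approximating from the right on a grid (`lintegral_eval_eq`).

The clocks need not be bounded, but the rates grow at most linearly in the number of events.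
Switching the rates off after `n` events gives bounded clocks; Grönwall bounds the mean number of
events independently of `n`, and monotone convergence removes the truncation. The finite mean also
justifies Fubini. -/

/-- `y` is locally constant to the right of every point. -/
def RightConst (y : ℝ → ℕ) : Prop := ∀ a, ∀ᶠ b in 𝓝[≥] a, y b = y a

/-- `A` solves `A i r = ∫ s in 0..r, g i s (y (A s))` on `[0, t]`: the internal clocks of a system
with rates `g` depending on the numbers of events, the event times of type `j` being
given by the counting path `y j`. -/
structure IsClock {ι : Type*} (g : ι → ℝ → (ι → ℕ) → ℝ) (y : ι → ℝ → ℕ) (t : ℝ)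
    (A : ℝ → ι → ℝ) : Prop where
  integrable : ∀ i, IntervalIntegrable (fun s => g i s (fun j => y j (A s j))) volume 0 t
  eq : ∀ r ∈ Icc 0 t, ∀ i, A r i = ∫ s in 0..r, g i s (fun j => y j (A s j))

/-! ### Pathwise theory of the clocks: regularity, uniqueness, dependence on the paths -/

section Pathwise

variable {ι : Type*} {g : ι → ℝ → (ι → ℕ) → ℝ} {y y' : ι → ℝ → ℕ} {t : ℝ} {A B : ℝ → ι → ℝ}

lemma IsClock.intervalIntegrable (h : IsClock g y t A) {a b : ℝ} (ha : a ∈ Icc 0 t)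
    (hb : b ∈ Icc 0 t) (i : ι) :
    IntervalIntegrable (fun s => g i s (fun j => y j (A s j))) volume a b := by
  refine (h.integrable i).mono_set ?_
  rw [uIcc_of_le (ha.1.trans ha.2)]
  exact uIcc_subset_Icc ha hb

lemma IsClock.sub_eq (h : IsClock g y t A) {a b : ℝ} (ha : a ∈ Icc 0 t) (hb : b ∈ Icc 0 t)
    (i : ι) : A b i - A a i = ∫ s in a..b, g i s (fun j => y j (A s j)) := by
  have h0 : (0 : ℝ) ∈ Icc 0 t := ⟨le_rfl, ha.1.trans ha.2⟩
  rw [h.eq b hb i, h.eq a ha i, intervalIntegral.integral_interval_sub_left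
    (h.intervalIntegrable h0 hb i) (h.intervalIntegrable h0 ha i)]

lemma IsClock.monotoneOn (h : IsClock g y t A) (hg : ∀ i s c, 0 ≤ g i s c) (i : ι) :
    MonotoneOn (fun s => A s i) (Icc 0 t) := by
  intro a ha b hb hab
  have := h.sub_eq ha hb i
  have h2 : 0 ≤ ∫ s in a..b, g i s (fun j => y j (A s j)) :=
    intervalIntegral.integral_nonneg hab fun _ _ => hg _ _ _
  simp only
  linarith

lemma IsClock.continuousOn (h : IsClock g y t A) (i : ι) :
    ContinuousOn (fun s => A s i) (Icc 0 t) := by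
  by_cases ht : 0 ≤ t
  · have := intervalIntegral.continuousOn_primitive_interval (μ := volume)
      (f := fun s => g i s (fun j => y j (A s j))) (a := 0) (b := t) (by
        have := (h.integrable i)
        rw [intervalIntegrable_iff_integrableOn_Icc_of_le ht] at this
        rwa [uIcc_of_le ht])
    rw [uIcc_of_le ht] at this
    exact this.congr fun r hr => h.eq r hr i
  · rw [Icc_eq_empty ht]; exact continuousOn_empty _

lemma IsClock.nonneg (h : IsClock g y t A) (hg : ∀ i s c, 0 ≤ g i s c) {r : ℝ}
    (hr : r ∈ Icc 0 t) (i : ι) : 0 ≤ A r i := by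
  rw [h.eq r hr i]
  exact intervalIntegral.integral_nonneg hr.1 fun _ _ => hg _ _ _

/-- To the right of `r`, the numbers of events do not change for a while. -/
lemma IsClock.exists_right_const [Finite ι] (h : IsClock g y t A) (hg : ∀ i s c, 0 ≤ g i s c)
    (hy : ∀ i, RightConst (y i)) {r : ℝ} (hr : r ∈ Ico 0 t) :
    ∃ e ∈ Ioc r t, ∀ s ∈ Icc r e, ∀ i, y i (A s i) = y i (A r i) := by
  have hr' : r ∈ Icc 0 t := ⟨hr.1, hr.2.le⟩
  have key : ∀ i, ∀ᶠ s in 𝓝[≥] r, y i (A s i) = y i (A r i) := by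
    intro i
    have hmem : Icc r t ∈ 𝓝[≥] r := Icc_mem_nhdsGE hr.2
    have hc : Tendsto (fun s => A s i) (𝓝[≥] r) (𝓝[≥] (A r i)) := by
      refine tendsto_nhdsWithin_iff.2 ⟨?_, ?_⟩
      · have h1 := (h.continuousOn i r hr').mono (Icc_subset_Icc_left hr.1)
        exact h1.mono_left (nhdsWithin_le_of_mem hmem)
      · filter_upwards [hmem] with s hs
        exact h.monotoneOn hg i hr' ⟨hr.1.trans hs.1, hs.2⟩ hs.1
    exact hc.eventually (hy i (A r i))
  have := (eventually_all.2 key)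
  obtain ⟨e, he, hsub⟩ := (mem_nhdsGE_iff_exists_Icc_subset).1 this
  have he' : r < e := he
  refine ⟨min e t, ⟨lt_min he' hr.2, min_le_right _ _⟩, fun s hs i => ?_⟩
  exact hsub ⟨hs.1, hs.2.trans (min_le_left _ _)⟩ i

/-- Continuous induction: the set of agreement is closed and contains `0`. To the right of a point
of agreement the event counts of both solutions stay frozen for a while at the same values, so the
rates coincide there and the agreement extends. No Lipschitz condition on `g` is needed. -/
theorem IsClock.unique [Finite ι] (hA : IsClock g y t A) (hB : IsClock g y t B)
    (hg : ∀ i s c, 0 ≤ g i s c) (hy : ∀ i, RightConst (y i)) : EqOn A B (Icc 0 t) := by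
  have hcA : ContinuousOn A (Icc 0 t) := continuousOn_pi.2 hA.continuousOn
  have hcB : ContinuousOn B (Icc 0 t) := continuousOn_pi.2 hB.continuousOn
  have hclosed : IsClosed ({r | A r = B r} ∩ Icc 0 t) := by
    have := (hcA.prodMk hcB).preimage_isClosed_of_isClosed isClosed_Icc
      (isClosed_diagonal (X := ι → ℝ))
    convert! this using 1
    ext r; simp [and_comm]
  rcases lt_or_ge t 0 with ht | ht
  · intro r hr; exact absurd (hr.1.trans hr.2) (not_le.2 ht)
  have h0 : (0 : ℝ) ∈ Icc 0 t := ⟨le_rfl, ht⟩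
  refine fun r hr => (hclosed.Icc_subset_of_forall_exists_gt (s := {r | A r = B r}) ?_ ?_) hr
  · ext i
    rw [hA.eq 0 h0, hB.eq 0 h0]; simp
  · rintro x ⟨hx, hxt⟩ z hz
    have hx' : A x = B x := hx
    obtain ⟨e, he, hAe⟩ := hA.exists_right_const hg hy hxt
    obtain ⟨e', he', hBe⟩ := hB.exists_right_const hg hy hxt
    have hxI : x ∈ Icc 0 t := ⟨hxt.1, hxt.2.le⟩
    let w := min z (min e e')
    have hxw : x < w := lt_min hz (lt_min he.1 he'.1)
    have hwe : w ≤ e := (min_le_right _ _).trans (min_le_left _ _)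
    have hwe' : w ≤ e' := (min_le_right _ _).trans (min_le_right _ _)
    have hwI : w ∈ Icc 0 t := ⟨hxt.1.trans hxw.le, hwe.trans he.2⟩
    refine ⟨w, ?_, hxw, min_le_left _ _⟩
    ext i
    have h1 := hA.sub_eq hxI hwI i
    have h2 := hB.sub_eq hxI hwI i
    have h3 : (∫ s in x..w, g i s (fun j => y j (A s j))) =
        ∫ s in x..w, g i s (fun j => y j (B s j)) := by
      refine intervalIntegral.integral_congr fun s hs => ?_
      rw [uIcc_of_le hxw.le] at hs
      refine congrArg (g i s) (funext fun j => ?_)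
      rw [hAe s ⟨hs.1, hs.2.trans hwe⟩ j, hBe s ⟨hs.1, hs.2.trans hwe'⟩ j, hx']
    rw [hx'] at h1
    linarith

/-- Changing the counting path `y i` beyond the final value of its clock changes nothing. -/
lemma IsClock.congr (h : IsClock g y t A) (hg : ∀ i s c, 0 ≤ g i s c) (ht : 0 ≤ t)
    (hyy : ∀ j, ∀ a ∈ Icc 0 (A t j), y j a = y' j a) : IsClock g y' t A := by
  have key : ∀ s ∈ Icc 0 t, ∀ j, y j (A s j) = y' j (A s j) := fun s hs j =>
    hyy j _ ⟨h.nonneg hg hs j, h.monotoneOn hg j hs ⟨hs.1.trans hs.2, le_rfl⟩ hs.2⟩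
  constructor
  · intro i
    refine (h.integrable i).congr fun s hs => ?_
    rw [uIoc_of_le ht] at hs
    simp only [key s ⟨hs.1.le, hs.2⟩]
  · intro r hr i
    rw [h.eq r hr i]
    refine intervalIntegral.integral_congr fun s hs => ?_
    rw [uIcc_of_le hr.1] at hs
    simp only [key s ⟨hs.1, hs.2.trans hr.2⟩]

end Pathwise

/-! ### Counting paths coded by their values at rational times -/

/-- The right-continuous function on `ℝ` determined by a monotone function on `ℚ`. -/
noncomputable def ratExt (y : ℚ → ℕ) (a : ℝ) : ℕ := sInf (y '' {q : ℚ | a < q})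

lemma image_lt_nonempty (y : ℚ → ℕ) (a : ℝ) : (y '' {q : ℚ | a < q}).Nonempty := by
  obtain ⟨q, hq⟩ := exists_rat_gt a
  exact ⟨_, mem_image_of_mem y hq⟩

lemma ratExt_le_iff (y : ℚ → ℕ) (a : ℝ) (n : ℕ) :
    ratExt y a ≤ n ↔ ∃ q : ℚ, a < q ∧ y q ≤ n := by
  constructor
  · intro h
    obtain ⟨q, hq, hq'⟩ := Nat.sInf_mem (image_lt_nonempty y a)
    exact ⟨q, hq, hq'.le.trans h⟩
  · rintro ⟨q, hq, hn⟩
    exact (Nat.sInf_le (mem_image_of_mem y hq)).trans hn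

/-- This holds for every `y`, monotone or not, so uniqueness of the clocks is available at every
point of the coded path space, without removing a null set. -/
lemma ratExt_rightConst (y : ℚ → ℕ) : RightConst (ratExt y) := by
  intro a
  obtain ⟨q, hq, hn⟩ := (ratExt_le_iff y a _).1 le_rfl
  filter_upwards [Ico_mem_nhdsGE hq] with b hb
  refine le_antisymm ((ratExt_le_iff y b _).2 ⟨q, hb.2, hn⟩) ?_
  obtain ⟨q', hq', hn'⟩ := (ratExt_le_iff y b _).1 le_rfl
  exact (ratExt_le_iff y a _).2 ⟨q', hb.1.trans_lt hq', hn'⟩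

lemma measurable_ratExt : Measurable (fun p : (ℚ → ℕ) × ℝ => ratExt p.1 p.2) := by
  refine measurable_of_Iic fun n => ?_
  have : (fun p : (ℚ → ℕ) × ℝ => ratExt p.1 p.2) ⁻¹' Iic n =
      ⋃ q : ℚ, {p : (ℚ → ℕ) × ℝ | p.2 < q} ∩ {p | p.1 q ≤ n} := by
    ext p; simp [ratExt_le_iff]
  rw [this]
  refine MeasurableSet.iUnion fun q => ?_
  refine (measurableSet_lt measurable_snd measurable_const).inter ?_
  exact measurableSet_le ((measurable_pi_apply q).comp measurable_fst) measurable_const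

lemma ratExt_restrict {z : ℝ → ℕ} (hz : Monotone z) (hz' : RightConst z) (a : ℝ) :
    ratExt (fun q => z q) a = z a := by
  apply le_antisymm
  · rw [ratExt_le_iff]
    obtain ⟨e, he, hsub⟩ := (mem_nhdsGE_iff_exists_Ico_subset).1 (hz' a)
    obtain ⟨q, hq, hq'⟩ := exists_rat_btwn (show a < e from he)
    exact ⟨q, hq, (hsub ⟨hq.le, hq'⟩ : z q = z a).le⟩
  · obtain ⟨q, hq, hn⟩ := (ratExt_le_iff (fun q => z q) a _).1 le_rfl
    exact (hz hq.le).trans hn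

lemma rightConst_min_toNNReal {Y : ℝ≥0 → ℕ} (hY : ∀ t, ContinuousWithinAt Y (Ici t) t)
    (u : ℝ≥0) : RightConst (fun a => Y (min a.toNNReal u)) := by
  intro a
  have hc : Tendsto (fun b : ℝ => min b.toNNReal u) (𝓝[≥] a) (𝓝[≥] (min a.toNNReal u)) := by
    refine tendsto_nhdsWithin_iff.2 ⟨?_, ?_⟩
    · exact (Continuous.tendsto (by fun_prop) a).mono_left nhdsWithin_le_nhds
    · filter_upwards [self_mem_nhdsWithin] with b hb
      exact min_le_min_right _ (Real.toNNReal_le_toNNReal hb)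
  have := (hY (min a.toNNReal u)).tendsto.comp hc
  rw [nhds_discrete, tendsto_pure] at this
  exact this

lemma monotone_min_toNNReal {Y : ℝ≥0 → ℕ} (hY : Monotone Y) (u : ℝ≥0) :
    Monotone (fun a : ℝ => Y (min a.toNNReal u)) :=
  fun _ _ hab => hY (min_le_min_right _ (Real.toNNReal_le_toNNReal hab))

lemma rightConst_toNNReal {Y : ℝ≥0 → ℕ} (hY : ∀ t, ContinuousWithinAt Y (Ici t) t) :
    RightConst (fun a => Y a.toNNReal) := by
  intro a
  have hc : Tendsto (fun b : ℝ => b.toNNReal) (𝓝[≥] a) (𝓝[≥] a.toNNReal) := by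
    refine tendsto_nhdsWithin_iff.2 ⟨?_, ?_⟩
    · exact (Continuous.tendsto (by fun_prop) a).mono_left nhdsWithin_le_nhds
    · filter_upwards [self_mem_nhdsWithin] with b hb
      exact Real.toNNReal_le_toNNReal hb
  have := (hY a.toNNReal).tendsto.comp hc
  rw [nhds_discrete, tendsto_pure] at this
  exact this

/-! ### Measurable dependence of the clocks on the counting paths -/

/-- Measurable rates with values in `[0, C]`. -/
structure IsBoundedRate {ι : Type*} (g : ι → ℝ → (ι → ℕ) → ℝ) (C : ℝ) : Prop where
  measurable : ∀ i, Measurable (fun p : ℝ × (ι → ℕ) => g i p.1 p.2)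
  nonneg : ∀ i s c, 0 ≤ g i s c
  le : ∀ i s c, g i s c ≤ C

section Measurability

variable {ι : Type*} {g : ι → ℝ → (ι → ℕ) → ℝ} {C : ℝ}

lemma IsBoundedRate.intervalIntegrable (hg : IsBoundedRate g C) (i : ι) {n : ℝ → ι → ℕ}
    (hn : Measurable n) (a b : ℝ) : IntervalIntegrable (fun s => g i s (n s)) volume a b := by
  have hm : Measurable fun s => g i s (n s) := (hg.measurable i).comp (measurable_id.prodMk hn)
  refine (intervalIntegrable_const (c := C)).mono_fun hm.aestronglyMeasurable ?_
  refine ae_of_all _ fun s => ?_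
  simp only
  rw [Real.norm_of_nonneg (hg.nonneg i s _),
    Real.norm_of_nonneg ((hg.nonneg i s (n s)).trans (hg.le i s _))]
  exact hg.le i s _

/-- Whether the clock `i` is below `u` at time `t` is a measurable function of the counting paths,
by the Lusin–Souslin theorem: the clocks are determined by the counting paths. -/
theorem exists_measurableSet_clock_lt [Finite ι] (hg : IsBoundedRate g C) {t : ℝ} (ht : 0 ≤ t)
    (i : ι) (u : ℝ) : ∃ S : Set (ι → ℚ → ℕ), MeasurableSet S ∧
      ∀ y, y ∈ S ↔ ∃ A, IsClock g (fun j => ratExt (y j)) t A ∧ A t i < u := by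
  have := Fintype.ofFinite ι
  let _ : MeasurableSpace C(Icc 0 t, ι → ℝ) := borel _
  have _ : BorelSpace C(Icc 0 t, ι → ℝ) := ⟨rfl⟩
  let pr : ℝ → Icc 0 t := projIcc 0 t ht
  have hpr : Continuous pr := continuous_projIcc
  let n : (ι → ℚ → ℕ) × C(Icc 0 t, ι → ℝ) → ℝ → ι → ℕ :=
    fun p s j => ratExt (p.1 j) (p.2 (pr s) j)
  have hev : Measurable fun x : C(Icc 0 t, ι → ℝ) × ℝ => x.1 (pr x.2) := by
    have : Continuous fun x : C(Icc 0 t, ι → ℝ) × ℝ => x.1 (pr x.2) := by fun_prop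
    exact this.measurable
  have hn : Measurable fun x : ((ι → ℚ → ℕ) × C(Icc 0 t, ι → ℝ)) × ℝ => n x.1 x.2 := by
    refine measurable_pi_lambda _ fun j => ?_
    refine measurable_ratExt.comp (Measurable.prodMk ?_ ?_)
    · exact (measurable_pi_apply j).comp (measurable_fst.comp measurable_fst)
    · exact (measurable_pi_apply j).comp
        (hev.comp ((measurable_snd.comp measurable_fst).prodMk measurable_snd))
  have hns : ∀ p, Measurable (n p) := fun p => hn.comp (measurable_const.prodMk measurable_id)
  -- Pairs of coded paths and continuous clocks that solve the clock equation. Asking for it at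
  -- rational times only keeps the number of conditions countable; continuity recovers all times in
  -- `hclock`.
  let E : Set ((ι → ℚ → ℕ) × C(Icc 0 t, ι → ℝ)) :=
    {p | (∀ q : ℚ, ∀ j, p.2 (pr q) j = ∫ s in (0 : ℝ)..(pr q : ℝ), g j s (n p s)) ∧
      p.2 (pr t) i < u}
  have hE : MeasurableSet E := by
    have hev' : ∀ r j, Measurable fun p : (ι → ℚ → ℕ) × C(Icc 0 t, ι → ℝ) => p.2 (pr r) j :=
      fun r j => (measurable_pi_apply j).comp (hev.comp (measurable_snd.prodMk measurable_const))
    refine Measurable.setOf (.and (.forall fun q => .forall fun j => ?_)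
      (measurableSet_setOfPred.1 (measurableSet_lt (hev' t i) measurable_const)))
    refine measurableSet_setOfPred.1 (measurableSet_eq_fun (hev' q j) ?_)
    simp_rw [intervalIntegral.integral_of_le (pr q).2.1]
    have hm : Measurable fun x : ((ι → ℚ → ℕ) × C(Icc 0 t, ι → ℝ)) × ℝ => g j x.2 (n x.1 x.2) :=
      (hg.measurable j).comp (measurable_snd.prodMk hn)
    exact (hm.stronglyMeasurable.integral_prod_right'
      (ν := volume.restrict (Ioc 0 (pr q : ℝ)))).measurable
  have hclock : ∀ p ∈ E, IsClock g (fun j => ratExt (p.1 j)) t (fun s => p.2 (pr s)) := by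
    intro p hp
    refine ⟨fun j => hg.intervalIntegrable j (hns p) _ _, fun r hr j => ?_⟩
    have hint : ∀ a b, IntervalIntegrable (fun s => g j s (n p s)) volume a b :=
      hg.intervalIntegrable j (hns p)
    have h1 : Continuous fun r => p.2 (pr r) j :=
      (continuous_apply j).comp ((map_continuous p.2).comp hpr)
    have h2 : Continuous fun r => ∫ s in (0 : ℝ)..(pr r : ℝ), g j s (n p s) :=
      (intervalIntegral.continuous_primitive hint 0).comp (continuous_subtype_val.comp hpr)
    have h3 := congrFun (Rat.denseRange_cast.equalizer h1 h2 (funext fun q => hp.1 q j)) r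
    have h4 : (pr r : ℝ) = r := by rw [show pr r = ⟨r, hr⟩ from projIcc_of_mem ht hr]
    simp only [h4] at h3
    exact h3
  -- By uniqueness the projection to the paths is injective on `E`, so the image of `E` is
  -- measurable and not merely analytic.
  have hinj : InjOn Prod.fst E := by
    rintro ⟨y, A⟩ hp ⟨y', B⟩ hp' hyy
    obtain rfl : y = y' := hyy
    have := (hclock (y, A) hp).unique (hclock (y, B) hp') hg.nonneg fun j => ratExt_rightConst _
    refine congrArg (Prod.mk y) (ContinuousMap.ext fun r => ?_)
    have h := this r.2
    simpa only [pr, projIcc_val] using h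
  refine ⟨Prod.fst '' E, hE.image_of_measurable_injOn measurable_fst hinj, fun y => ?_⟩
  constructor
  · rintro ⟨p, hp, rfl⟩
    exact ⟨_, hclock p hp, hp.2⟩
  · rintro ⟨A, hA, hu⟩
    refine ⟨(y, ⟨fun r j => A r j, ?_⟩), ⟨fun q j => ?_, ?_⟩, rfl⟩
    · exact continuous_pi fun j => continuousOn_iff_continuous_domRestrict.1 (hA.continuousOn j)
    · have h1 := hA.eq (pr q) (pr q).2 j
      simp only [ContinuousMap.coe_mk, h1]
      refine intervalIntegral.integral_congr fun s hs => ?_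
      rw [uIcc_of_le (pr q).2.1] at hs
      have h4 : (pr s : ℝ) = s := by
        rw [show pr s = ⟨s, ⟨hs.1, hs.2.trans (pr q).2.2⟩⟩ from projIcc_of_mem ht _]
      simp [n, h4]
    · have h4 : (pr t : ℝ) = t := by simp [pr]
      simpa [h4] using hu

end Measurability

/-! ### Poisson means, and independence of the past from later increments -/

lemma lintegral_natCast_poissonMeasure (r : ℝ≥0) :
    ∫⁻ n, (n : ℝ≥0∞) ∂poissonMeasure r = r := by
  rw [lintegral_countable']
  have h : ∀ n : ℕ, (n : ℝ≥0∞) * poissonMeasure r {n} =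
      ENNReal.ofReal (n * (Real.exp (-r) * r ^ n / (n.factorial))) := fun n => by
    rw [poissonMeasure_singleton, ENNReal.ofReal_mul (by positivity), ENNReal.ofReal_natCast]
  have hs : HasSum (fun n : ℕ => (n : ℝ) * (Real.exp (-r) * r ^ n / (n.factorial))) r := by
    -- The term at `0` vanishes, and after the shift the `(n + 1)`-st term is `r` times the Poisson
    -- weight of `n`.
    refine (hasSum_nat_add_iff' 1).1 ?_
    have h1 := (hasSum_one_poissonMeasure r).mul_left (r : ℝ)
    simp only [Finset.range_one, Finset.sum_singleton, Nat.cast_zero, zero_mul, sub_zero]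
    rw [mul_one] at h1
    refine h1.congr_fun fun n => ?_
    rw [Nat.factorial_succ]
    push_cast
    have : (n.factorial : ℝ) ≠ 0 := by positivity
    have : (n : ℝ) + 1 ≠ 0 := by positivity
    field_simp
    ring
  simp_rw [h]
  rw [← ENNReal.ofReal_tsum_of_nonneg (fun n => by positivity) hs.summable, hs.tsum_eq,
    ENNReal.ofReal_coe_nnreal]

section Poisson

variable {Ω : Type*} [MeasurableSpace Ω] {μ : Measure Ω} {Y : ℝ≥0 → Ω → ℕ}

lemma IsUnitPoissonProcess.lintegral_sub (hY : IsUnitPoissonProcess μ Y) {s t : ℝ≥0}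
    (hst : s ≤ t) : ∫⁻ ω, ((Y t ω - Y s ω : ℕ) : ℝ≥0∞) ∂μ = (t - s : ℝ≥0) := by
  have hm : Measurable fun ω => Y t ω - Y s ω := (hY.measurable t).sub (hY.measurable s)
  rw [← lintegral_natCast_poissonMeasure, ← (hY.law s t hst).map_eq,
    lintegral_map (measurable_of_countable _) hm]

/-- The values at times up to `u` are sums of increments over the sorted times, all of which are
independent of the increment from `u` to `v`. -/
lemma IsUnitPoissonProcess.indepFun_finset_sub (hY : IsUnitPoissonProcess μ Y) {u v : ℝ≥0}
    (huv : u ≤ v) (I : Finset ℝ≥0) (hI : ∀ x ∈ I, x ≤ u) :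
    IndepFun (fun ω (x : I) => Y x ω) (fun ω => Y v ω - Y u ω) μ := by
  classical
  -- Time `0` is added so that, since `Y 0 = 0` almost surely, values are sums of increments
  -- starting at `0`.
  let J := insert 0 I
  have hJ : ∀ x ∈ J, x ≤ u := by
    intro x hx
    rcases Finset.mem_insert.1 hx with rfl | hx
    · exact zero_le
    · exact hI x hx
  let e := J.orderEmbOfFin rfl
  -- The sorted elements of `J`, then `u`, then `v` forever: increment number `J.card` is the one
  -- over `(u, v]`, and all earlier ones lie below `u`.
  let τ : ℕ → ℝ≥0 := fun m => if h : m < J.card then e ⟨m, h⟩ else if m = J.card then u else v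
  have hτe : ∀ m (h : m < J.card), τ m = e ⟨m, h⟩ := fun m h => dif_pos h
  have hτJ : ∀ m, m < J.card → τ m ≤ u := fun m h => by
    rw [hτe m h]; exact hJ _ (J.orderEmbOfFin_mem rfl _)
  have hτu : τ J.card = u := by simp [τ]
  have hτv : ∀ m, J.card < m → τ m = v := fun m h => by simp [τ, h.not_gt, h.ne']
  have hmono : Monotone τ := by
    intro a b hab
    rcases lt_trichotomy b J.card with hb | hb | hb
    · rw [hτe a (hab.trans_lt hb), hτe b hb]
      exact e.monotone hab
    · rw [hb, hτu]
      rcases hab.lt_or_eq with h | h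
      · exact hτJ a (hb ▸ h)
      · rw [h, hb, hτu]
    · rw [hτv b hb]
      rcases lt_trichotomy a J.card with ha | ha | ha
      · exact (hτJ a ha).trans huv
      · rw [ha, hτu]; exact huv
      · rw [hτv a ha]
  have hidx : ∀ x ∈ J, ∃ m, m < J.card ∧ τ m = x := fun x hx => by
    have : x ∈ Set.range e := by rw [J.range_orderEmbOfFin rfl]; exact hx
    obtain ⟨m, rfl⟩ := this
    exact ⟨m, m.2, hτe m m.2⟩
  have hτ0 : τ 0 = 0 := by
    obtain ⟨m, hm, h0⟩ := hidx 0 (Finset.mem_insert_self _ _)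
    exact le_antisymm (h0 ▸ hmono (zero_le : 0 ≤ m)) zero_le
  choose! idx hidx1 hidx2 using hidx
  have hind := (hY.indep.nat hmono).indepFun_finset (Finset.range J.card) {J.card}
    (by simp) (fun i => (hY.measurable _).sub (hY.measurable _))
  let φ : ((Finset.range J.card) → ℕ) → I → ℕ :=
    fun d x => ∑ i : Finset.range J.card, if (i : ℕ) < idx x then d i else 0
  have h2 := hind.comp (φ := φ)
    (ψ := fun d : ({J.card} : Finset ℕ) → ℕ => d ⟨J.card, Finset.mem_singleton_self _⟩)
    (measurable_of_countable _) (measurable_of_countable _)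
  refine h2.congr ?_ ?_
  · filter_upwards [hY.start, hY.paths] with ω h0 hp
    ext x
    have hxJ : (x : ℝ≥0) ∈ J := Finset.mem_insert_of_mem x.2
    simp only [Function.comp_apply, φ]
    rw [Finset.sum_coe_sort (Finset.range J.card) (fun i =>
      if i < idx x then Y (τ (i + 1)) ω - Y (τ i) ω else 0), ← Finset.sum_filter]
    have hf : (Finset.range J.card).filter (fun i => i < idx x) = Finset.range (idx x) := by
      ext i
      have := hidx1 x hxJ
      simp only [Finset.mem_filter, Finset.mem_range]
      omega
    rw [hf, Finset.sum_range_tsub (f := fun i => Y (τ i) ω) (fun a b hab => hp.1 (hmono hab)),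
      hτ0, h0, hidx2 x hxJ, Nat.sub_zero]
  · refine ae_of_all _ fun ω => ?_
    simp only [Function.comp_apply]
    rw [hτu, hτv _ (Nat.lt_succ_self _)]

/-- The path stopped at time `u` is independent of the increments after `u`. -/
lemma IsUnitPoissonProcess.indepFun_stopped_sub [IsProbabilityMeasure μ]
    (hY : IsUnitPoissonProcess μ Y) {u v : ℝ≥0} (huv : u ≤ v) :
    IndepFun (fun ω (q : ℚ) => Y (min (q : ℝ).toNNReal u) ω) (fun ω => Y v ω - Y u ω) μ := by
  classical
  refine IndepFun.process_indepFun (fun q => hY.measurable _)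
    ((hY.measurable v).sub (hY.measurable u)) fun I => ?_
  let K := I.image fun q : ℚ => min (q : ℝ).toNNReal u
  have hK : ∀ x ∈ K, x ≤ u := by
    intro x hx
    obtain ⟨q, -, rfl⟩ := Finset.mem_image.1 hx
    exact min_le_right _ _
  have h := hY.indepFun_finset_sub huv K hK
  exact h.comp (φ := fun z (q : I) => z ⟨_, Finset.mem_image_of_mem _ q.2⟩) (ψ := id)
    (measurable_pi_lambda _ fun q => measurable_pi_apply _) measurable_id

end Poisson

/-- The two hypotheses make the joint law of `X`, `Y`, `Z` a product of three measures, which may be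
regrouped at will. -/
lemma indepFun_prodMk_left {Ω α β γ : Type*} [MeasurableSpace Ω] [MeasurableSpace α]
    [MeasurableSpace β] [MeasurableSpace γ] {μ : Measure Ω} [IsProbabilityMeasure μ]
    {X : Ω → α} {Y : Ω → β} {Z : Ω → γ} (hX : Measurable X) (hY : Measurable Y)
    (hZ : Measurable Z) (hXY : IndepFun X Y μ) (hXYZ : IndepFun (fun ω => (X ω, Y ω)) Z μ) :
    IndepFun (fun ω => (X ω, Z ω)) Y μ := by
  have : IsProbabilityMeasure (μ.map X) := Measure.isProbabilityMeasure_map hX.aemeasurable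
  have : IsProbabilityMeasure (μ.map Y) := Measure.isProbabilityMeasure_map hY.aemeasurable
  have : IsProbabilityMeasure (μ.map Z) := Measure.isProbabilityMeasure_map hZ.aemeasurable
  have hXZ : IndepFun X Z μ := hXYZ.comp measurable_fst measurable_id
  rw [indepFun_iff_map_prod_eq_prod_map_map (hX.prodMk hZ).aemeasurable hY.aemeasurable,
    hXZ.map_prod_eq_prod_map_map hX.aemeasurable hZ.aemeasurable]
  have h := hXYZ.map_prod_eq_prod_map_map (hX.prodMk hY).aemeasurable hZ.aemeasurable
  rw [hXY.map_prod_eq_prod_map_map hX.aemeasurable hY.aemeasurable] at h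
  have hm : Measurable fun p : (α × β) × γ => ((p.1.1, p.2), p.1.2) := by fun_prop
  have h2 := congrArg (Measure.map fun p : (α × β) × γ => ((p.1.1, p.2), p.1.2)) h
  rw [Measure.map_map hm ((hX.prodMk hY).prodMk hZ)] at h2
  refine Eq.trans h2 ?_
  have hp := (measurePreserving_prodAssoc (μ.map X) (μ.map Z) (μ.map Y)).symm.comp
    (((MeasurePreserving.id (μ.map X)).prod
      (Measure.measurePreserving_swap (μ := μ.map Y) (ν := μ.map Z))).comp
      (measurePreserving_prodAssoc (μ.map X) (μ.map Y) (μ.map Z)))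
  exact hp.map_eq

/-! ### Independence for the whole family of processes -/

/-- The family of counting paths, the `i`-th one stopped at time `u`, sampled at the rationals. -/
def stoppedPaths {Ω ι : Type*} [DecidableEq ι] (Y : ι → ℝ≥0 → Ω → ℕ) (i : ι) (u : ℝ≥0) (ω : Ω) :
    ι → ℚ → ℕ :=
  fun j q => if j = i then Y j (min (q : ℝ).toNNReal u) ω else Y j (q : ℝ).toNNReal ω

section

variable {Ω ι : Type*} [MeasurableSpace Ω] {μ : Measure Ω}
  [DecidableEq ι] {Y : ι → ℝ≥0 → Ω → ℕ}

lemma measurable_stoppedPaths (hY : ∀ i, IsUnitPoissonProcess μ (Y i)) (i : ι) (u : ℝ≥0) :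
    Measurable (stoppedPaths Y i u) := by
  refine measurable_pi_lambda _ fun j => measurable_pi_lambda _ fun q => ?_
  unfold stoppedPaths
  split_ifs
  · exact (hY j).measurable _
  · exact (hY j).measurable _

lemma indepFun_stoppedPaths_sub [Fintype ι] [IsProbabilityMeasure μ]
    (hY : ∀ i, IsUnitPoissonProcess μ (Y i))
    (hind : iIndepFun (fun i ω t => Y i t ω) μ) (i : ι) {u v : ℝ≥0} (huv : u ≤ v) :
    IndepFun (stoppedPaths Y i u) (fun ω => Y i v ω - Y i u ω) μ := by
  have hm : ∀ i, Measurable fun ω t => Y i t ω := fun i =>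
    measurable_pi_lambda _ fun t => (hY i).measurable t
  have h1 := hind.indepFun_finset {i} {i}ᶜ disjoint_compl_right hm
  have hd : Measurable fun ω => Y i v ω - Y i u ω :=
    ((hY i).measurable v).sub ((hY i).measurable u)
  -- Both the stopped path and the later increment are read off process `i`, so the pair is jointly
  -- independent of the other processes; regrouping then moves those to the side of the stopped
  -- path.
  let φ : (({i} : Finset ι) → ℝ≥0 → ℕ) → (ℚ → ℕ) × ℕ := fun z =>
    ((fun q : ℚ => z ⟨i, Finset.mem_singleton_self i⟩ (min (q : ℝ).toNNReal u)),
      z ⟨i, Finset.mem_singleton_self i⟩ v - z ⟨i, Finset.mem_singleton_self i⟩ u)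
  have hφ : Measurable φ := by fun_prop
  have h2 : IndepFun (fun ω => ((fun q : ℚ => Y i (min (q : ℝ).toNNReal u) ω),
      Y i v ω - Y i u ω)) (fun ω (j : ({i}ᶜ : Finset ι)) t => Y j t ω) μ :=
    h1.comp hφ measurable_id
  have h3 := indepFun_prodMk_left
    (measurable_pi_lambda _ fun q => (hY i).measurable _)
    hd (measurable_pi_lambda _ fun j : ({i}ᶜ : Finset ι) => hm j)
    ((hY i).indepFun_stopped_sub huv) h2
  let ψ : (ℚ → ℕ) × (({i}ᶜ : Finset ι) → ℝ≥0 → ℕ) → ι → ℚ → ℕ := fun z j q =>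
    if h : j = i then z.1 q else z.2 ⟨j, by simpa using h⟩ (q : ℝ).toNNReal
  have hψ : Measurable ψ := by
    refine measurable_pi_lambda _ fun j => measurable_pi_lambda _ fun q => ?_
    by_cases h : j = i
    · simp only [ψ, h, dif_pos]; fun_prop
    · simp only [ψ, h, dif_neg, not_false_eq_true]; fun_prop
  have h4 : IndepFun (fun ω => ψ ((fun q : ℚ => Y i (min (q : ℝ).toNNReal u) ω),
      fun (j : ({i}ᶜ : Finset ι)) t => Y j t ω)) (fun ω => Y i v ω - Y i u ω) μ :=
    h3.comp hψ measurable_id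
  convert! h4 using 1
  ext ω j q
  by_cases h : j = i
  · subst h; simp [stoppedPaths, ψ]
  · simp [stoppedPaths, ψ, h]

end

/-! ### Optional stopping for a unit Poisson process -/

section Wald

variable {Ω : Type*} [MeasurableSpace Ω] {μ : Measure Ω}
  {Y : ℝ≥0 → Ω → ℕ} {τ : Ω → ℝ≥0}

/-- The least multiple of `h` which is greater than `x`. -/
noncomputable def gridAbove (h x : ℝ≥0) : ℝ≥0 := (⌊x / h⌋₊ + 1 : ℕ) * h

lemma lt_gridAbove {h : ℝ≥0} (hh : 0 < h) (x : ℝ≥0) : x < gridAbove h x := by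
  have := Nat.lt_floor_add_one (x / h)
  rw [div_lt_iff₀ hh] at this
  simpa [gridAbove] using this

lemma gridAbove_le {h : ℝ≥0} (hh : 0 < h) (x : ℝ≥0) : gridAbove h x ≤ x + h := by
  have := Nat.floor_le (zero_le : 0 ≤ x / h)
  rw [le_div_iff₀ hh] at this
  simp only [gridAbove, Nat.cast_add, Nat.cast_one, add_mul, one_mul]
  gcongr

/-- A function of the grid time `gridAbove h x` as the sum of its increments. -/
lemma gridAbove_eq_tsum {h : ℝ≥0} (hh : 0 < h) (x : ℝ≥0) (F : ℕ → ℝ≥0∞) :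
    ∑ m ∈ Finset.range (⌊x / h⌋₊ + 1), F m = ∑' m : ℕ, if (m : ℝ≥0) * h ≤ x then F m else 0 := by
  have hiff : ∀ m : ℕ, (m : ℝ≥0) * h ≤ x ↔ m ∈ Finset.range (⌊x / h⌋₊ + 1) := fun m => by
    rw [Finset.mem_range, Nat.lt_succ_iff, Nat.le_floor_iff zero_le, le_div_iff₀ hh]
  simp_rw [hiff]
  rw [tsum_eq_sum (s := Finset.range (⌊x / h⌋₊ + 1)) (fun m hm => if_neg hm)]
  exact Finset.sum_congr rfl fun m hm => (if_pos hm).symm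

/-- Wald's identity on a grid. `Y` at the grid time is the sum of the increments over the cells
whose left end `m * h` is at most `τ`. Each cell is entered according to `m * h ≤ τ`, a condition of
the form covered by `hw`, so it contributes `h` times the probability of that event. -/
theorem lintegral_gridAbove (hY : IsUnitPoissonProcess μ Y) (hτ : AEMeasurable τ μ)
    (hw : ∀ u v, u ≤ v → ∫⁻ ω, (if u ≤ τ ω then ((Y v ω - Y u ω : ℕ) : ℝ≥0∞) else 0) ∂μ =
      μ {ω | u ≤ τ ω} * (v - u : ℝ≥0)) {h : ℝ≥0} (hh : 0 < h) :
    ∫⁻ ω, (Y (gridAbove h (τ ω)) ω : ℝ≥0∞) ∂μ = ∫⁻ ω, (gridAbove h (τ ω) : ℝ≥0∞) ∂μ := by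
  have hset : ∀ u : ℝ≥0, NullMeasurableSet {ω | u ≤ τ ω} μ := fun u =>
    hτ.nullMeasurableSet_preimage measurableSet_Ici
  have hif : ∀ (u : ℝ≥0) (F : Ω → ℝ≥0∞), Measurable F →
      AEMeasurable (fun ω => if u ≤ τ ω then F ω else 0) μ := fun u F hF =>
    (hF.aemeasurable.indicator₀ (hset u)).congr (ae_of_all _ fun ω => by
      simp [indicator_apply])
  have h1 : ∀ᵐ ω ∂μ, (Y (gridAbove h (τ ω)) ω : ℝ≥0∞) = ∑' m : ℕ, if (m : ℝ≥0) * h ≤ τ ω then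
      ((Y ((m + 1 : ℕ) * h) ω - Y (m * h) ω : ℕ) : ℝ≥0∞) else 0 := by
    filter_upwards [hY.start, hY.paths] with ω h0 hp
    have hmono : Monotone fun m : ℕ => Y (m * h) ω := fun a b hab => hp.1 (by gcongr)
    rw [← gridAbove_eq_tsum hh, ← Nat.cast_sum, Finset.sum_range_tsub hmono]
    simp [h0, gridAbove]
  have h2 : ∀ ω, (gridAbove h (τ ω) : ℝ≥0∞) =
      ∑' m : ℕ, if (m : ℝ≥0) * h ≤ τ ω then (h : ℝ≥0∞) else 0 := by
    intro ω
    rw [← gridAbove_eq_tsum hh]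
    simp [gridAbove]
  rw [lintegral_congr_ae h1, lintegral_congr h2,
    lintegral_tsum fun m => hif _ _ ?_, lintegral_tsum fun m => hif _ _ measurable_const]
  · refine tsum_congr fun m => ?_
    rw [hw _ _ (by gcongr; simp)]
    have h3 : ((m + 1 : ℕ) : ℝ≥0) * h - m * h = h := by
      rw [Nat.cast_add, Nat.cast_one, add_mul, one_mul, add_tsub_cancel_left]
    rw [h3]
    have h4 : ∀ ω, (if (m : ℝ≥0) * h ≤ τ ω then (h : ℝ≥0∞) else 0) =
        {ω | (m : ℝ≥0) * h ≤ τ ω}.indicator (fun _ => (h : ℝ≥0∞)) ω := fun ω => by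
      simp [indicator_apply]
    rw [lintegral_congr h4, lintegral_indicator_const₀ (hset _), mul_comm]
  · exact (measurable_of_countable (fun n : ℕ => (n : ℝ≥0∞))).comp
      ((hY.measurable _).sub (hY.measurable _))

lemma tendsto_gridAbove (x : ℝ≥0) :
    Tendsto (fun n : ℕ => gridAbove (1 / (n + 1)) x) atTop (𝓝[≥] x) := by
  have hpos : ∀ n : ℕ, (0 : ℝ≥0) < 1 / (n + 1) := fun n => by positivity
  refine tendsto_nhdsWithin_iff.2 ⟨?_, Eventually.of_forall fun n => (lt_gridAbove (hpos n) x).le⟩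
  refine tendsto_of_tendsto_of_tendsto_of_le_of_le tendsto_const_nhds ?_
    (fun n => (lt_gridAbove (hpos n) x).le) fun n => gridAbove_le (hpos n) x
  have h := (tendsto_one_div_add_atTop_nhds_zero_nat (𝕜 := ℝ≥0)).const_add x
  rwa [add_zero] at h

lemma aemeasurable_eval_gridAbove (hY : IsUnitPoissonProcess μ Y) (hτ : AEMeasurable τ μ)
    (h : ℝ≥0) : AEMeasurable (fun ω => Y (gridAbove h (τ ω)) ω) μ := by
  have hk : AEMeasurable (fun ω => ⌊τ ω / h⌋₊) μ :=
    Nat.measurable_floor.comp_aemeasurable (hτ.div_const h)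
  have key : ∀ s : ℕ → ℝ≥0, Measurable fun p : ℕ × Ω => Y (s p.1) p.2 := fun s =>
    measurable_from_prod_countable_right fun m => hY.measurable (s m)
  have h1 := (key fun m => ((m + 1 : ℕ) : ℝ≥0) * h).comp_aemeasurable
    (hk.prodMk aemeasurable_id)
  simp only [gridAbove]
  exact h1

/-- On a grid only countably many fixed times occur; approaching `τ` from the right, the side on
which the paths are continuous, passes measurability to the limit. -/
lemma aemeasurable_eval (hY : IsUnitPoissonProcess μ Y) (hτ : AEMeasurable τ μ) :
    AEMeasurable (fun ω => Y (τ ω) ω) μ := by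
  refine aemeasurable_of_tendsto_metrizable_ae atTop
    (fun n : ℕ => aemeasurable_eval_gridAbove hY hτ (1 / (n + 1))) ?_
  filter_upwards [hY.paths] with ω hp
  exact (hp.2 (τ ω)).tendsto.comp (tendsto_gridAbove (τ ω))

/-- Optional stopping for a unit Poisson process at a bounded random time `τ` such that
the event `u ≤ τ` does not influence the mean of the increments after `u`. -/
theorem lintegral_eval_eq [IsProbabilityMeasure μ] (hY : IsUnitPoissonProcess μ Y)
    (hτ : AEMeasurable τ μ) {M : ℝ≥0}
    (hM : ∀ᵐ ω ∂μ, τ ω ≤ M)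
    (hw : ∀ u v, u ≤ v → ∫⁻ ω, (if u ≤ τ ω then ((Y v ω - Y u ω : ℕ) : ℝ≥0∞) else 0) ∂μ =
      μ {ω | u ≤ τ ω} * (v - u : ℝ≥0)) :
    ∫⁻ ω, (Y (τ ω) ω : ℝ≥0∞) ∂μ = ∫⁻ ω, (τ ω : ℝ≥0∞) ∂μ := by
  have hpos : ∀ n : ℕ, (0 : ℝ≥0) < 1 / (n + 1) := fun n => by positivity
  have hle : ∀ (n : ℕ) (x : ℝ≥0), gridAbove (1 / (n + 1)) x ≤ x + 1 := fun n x =>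
    (gridAbove_le (hpos n) x).trans (by
      gcongr
      rw [div_le_one (by positivity)]
      simp)
  have hcast : Measurable fun n : ℕ => (n : ℝ≥0∞) := measurable_of_countable _
  have hmean : ∫⁻ ω, (Y (M + 1) ω : ℝ≥0∞) ∂μ ≠ ∞ := by
    have h := hY.lintegral_sub (zero_le : 0 ≤ M + 1)
    have h' : ∫⁻ ω, (Y (M + 1) ω : ℝ≥0∞) ∂μ = (M + 1 - 0 : ℝ≥0) := by
      rw [← h]
      refine lintegral_congr_ae ?_
      filter_upwards [hY.start] with ω h0
      simp [h0]
    rw [h']; exact ENNReal.coe_ne_top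
  have lim1 : Tendsto (fun n : ℕ => ∫⁻ ω, (Y (gridAbove (1 / (n + 1)) (τ ω)) ω : ℝ≥0∞) ∂μ) atTop
      (𝓝 (∫⁻ ω, (Y (τ ω) ω : ℝ≥0∞) ∂μ)) := by
    refine tendsto_lintegral_of_dominated_convergence' (fun ω => (Y (M + 1) ω : ℝ≥0∞))
      (fun n => hcast.comp_aemeasurable (aemeasurable_eval_gridAbove hY hτ _)) (fun n => ?_)
      hmean ?_
    · filter_upwards [hM, hY.paths] with ω hω hp
      have : Y (gridAbove (1 / (n + 1)) (τ ω)) ω ≤ Y (M + 1) ω :=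
        hp.1 ((hle n _).trans (by gcongr))
      exact_mod_cast this
    · filter_upwards [hY.paths] with ω hp
      have h := (hp.2 (τ ω)).tendsto.comp (tendsto_gridAbove (τ ω))
      rw [nhds_discrete, tendsto_pure] at h
      exact tendsto_const_nhds.congr' (h.mono fun n hn => by
        exact congrArg Nat.cast hn.symm)
  have lim2 : Tendsto (fun n : ℕ => ∫⁻ ω, (gridAbove (1 / (n + 1)) (τ ω) : ℝ≥0∞) ∂μ) atTop
      (𝓝 (∫⁻ ω, (τ ω : ℝ≥0∞) ∂μ)) := by
    refine tendsto_lintegral_of_dominated_convergence' (fun ω => ((M + 1 : ℝ≥0) : ℝ≥0∞))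
      (fun n => ?_) (fun n => ?_) (by simp) ?_
    · refine AEMeasurable.coe_nnreal_ennreal ?_
      have hk : AEMeasurable (fun ω => ⌊τ ω / (1 / ((n : ℝ≥0) + 1))⌋₊) μ :=
        Nat.measurable_floor.comp_aemeasurable (hτ.div_const _)
      exact ((measurable_of_countable (fun m : ℕ => ((m + 1 : ℕ) : ℝ≥0))).comp_aemeasurable
        hk).mul_const _
    · filter_upwards [hM] with ω hω
      exact ENNReal.coe_le_coe.2 ((hle n _).trans (by gcongr))
    · refine ae_of_all _ fun ω => ?_
      exact ENNReal.tendsto_coe.2 ((tendsto_gridAbove (τ ω)).mono_right nhdsWithin_le_nhds)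
  refine tendsto_nhds_unique lim1 (lim2.congr fun n => ?_)
  exact (lintegral_gridAbove hY hτ hw (hpos n)).symm

end Wald

/-! ### Wald's identity for clocks with bounded rates -/

section Bounded

variable {Ω : Type*} [MeasurableSpace Ω] {μ : Measure Ω} {ι : Type*}
  {g : ι → ℝ → (ι → ℕ) → ℝ} {C : ℝ} {Y : ι → ℝ≥0 → Ω → ℕ} {t : ℝ} {A : Ω → ℝ → ι → ℝ}

/-- Whether the clock `i` is below `u` depends only on the paths of the other processes and on
the path of the process `i` up to `u`. -/
lemma exists_measurableSet_stoppedPaths [Finite ι] [DecidableEq ι] (hg : IsBoundedRate g C)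
    (hY : ∀ i, IsUnitPoissonProcess μ (Y i)) (ht : 0 ≤ t)
    (hA : ∀ᵐ ω ∂μ, IsClock g (fun j a => Y j a.toNNReal ω) t (A ω)) (i : ι) (u : ℝ≥0) :
    ∃ D : Set (ι → ℚ → ℕ), MeasurableSet D ∧
      ∀ᵐ ω ∂μ, stoppedPaths Y i u ω ∈ D ↔ A ω t i < u := by
  obtain ⟨D, hD, h⟩ := exists_measurableSet_clock_lt hg ht i u
  refine ⟨D, hD, ?_⟩
  filter_upwards [hA, ae_all_iff.2 fun j => (hY j).paths] with ω hω hp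
  let z : ι → ℝ → ℕ := fun j a =>
    if j = i then Y j (min a.toNNReal u) ω else Y j a.toNNReal ω
  have hz : (fun j => ratExt (stoppedPaths Y i u ω j)) = z := by
    ext j a
    by_cases hj : j = i
    · have h1 : stoppedPaths Y i u ω j = fun q : ℚ => Y j (min (q : ℝ).toNNReal u) ω :=
        funext fun q => if_pos hj
      rw [h1]
      simp only [z, if_pos hj]
      exact ratExt_restrict (monotone_min_toNNReal (hp j).1 u)
        (rightConst_min_toNNReal (hp j).2 u) a
    · have h1 : stoppedPaths Y i u ω j = fun q : ℚ => Y j (q : ℝ).toNNReal ω :=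
        funext fun q => if_neg hj
      rw [h1]
      simp only [z, if_neg hj]
      exact ratExt_restrict (z := fun a => Y j a.toNNReal ω)
        (fun a b hab => (hp j).1 (Real.toNNReal_le_toNNReal hab)) (rightConst_toNNReal (hp j).2) a
  -- Stated for an arbitrary clock system ending below `u` in coordinate `i`, because it is used
  -- both to pass from the stopped paths to the original ones and back.
  have hagree : ∀ B : ℝ → ι → ℝ, B t i < u → ∀ j, ∀ a ∈ Icc 0 (B t j),
      z j a = Y j a.toNNReal ω := by
    intro B hB j a ha
    by_cases hj : j = i
    · subst hj
      simp only [z, if_true]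
      rw [min_eq_left]
      exact Real.toNNReal_le_iff_le_coe.2 (ha.2.trans hB.le)
    · simp only [z, hj, if_false]
  rw [h, hz]
  constructor
  · rintro ⟨B, hB, hBu⟩
    have hB' := hB.congr (y' := fun j a => Y j a.toNNReal ω) hg.nonneg ht (hagree B hBu)
    rw [hω.unique hB' hg.nonneg (fun j => rightConst_toNNReal (hp j).2) ⟨ht, le_rfl⟩]
    exact hBu
  · intro hu
    exact ⟨A ω, hω.congr hg.nonneg ht fun j a ha => (hagree _ hu j a ha).symm, hu⟩

theorem IsBoundedRate.aemeasurable_clock [Finite ι] (hg : IsBoundedRate g C)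
    (hY : ∀ i, IsUnitPoissonProcess μ (Y i)) (ht : 0 ≤ t)
    (hA : ∀ᵐ ω ∂μ, IsClock g (fun j a => Y j a.toNNReal ω) t (A ω)) (i : ι) :
    AEMeasurable (fun ω => (A ω t i).toNNReal) μ := by
  classical
  refine NullMeasurable.aemeasurable (f := fun ω => (A ω t i).toNNReal) ?_
  have key : ∀ u : ℝ≥0, NullMeasurableSet ((fun ω => (A ω t i).toNNReal) ⁻¹' Iio u) μ := by
    intro u
    obtain ⟨D, hD, h⟩ := exists_measurableSet_stoppedPaths hg hY ht hA i u
    have h1 : NullMeasurableSet (stoppedPaths Y i u ⁻¹' D) μ :=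
      (measurable_stoppedPaths hY i u hD).nullMeasurableSet
    refine h1.congr ?_
    filter_upwards [h, hA] with ω hω hAω
    exact propext (hω.trans
      (Real.toNNReal_lt_iff_lt_coe (hAω.nonneg hg.nonneg ⟨ht, le_rfl⟩ i)).symm)
  -- Null measurability is measurability for the σ-algebra of null measurable sets, so it suffices
  -- to check rays.
  exact @measurable_of_Iio _ (NullMeasurableSpace Ω μ) _ _ _ _ _ _ _ _ key

/-- The clock is at most `C * t`, so optional stopping applies; its condition on increments holds
because `u ≤ A ω t i` is an event of the stopped paths, which are independent of the increment after
`u`. -/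
theorem IsBoundedRate.lintegral_clock_eq [Finite ι] [IsProbabilityMeasure μ]
    (hg : IsBoundedRate g C) (hY : ∀ i, IsUnitPoissonProcess μ (Y i))
    (hind : iIndepFun (fun i ω t => Y i t ω) μ) (ht : 0 ≤ t)
    (hA : ∀ᵐ ω ∂μ, IsClock g (fun j a => Y j a.toNNReal ω) t (A ω)) (i : ι) :
    ∫⁻ ω, (Y i (A ω t i).toNNReal ω : ℝ≥0∞) ∂μ = ∫⁻ ω, ENNReal.ofReal (A ω t i) ∂μ := by
  classical
  have := Fintype.ofFinite ι
  refine lintegral_eval_eq (hY i) (hg.aemeasurable_clock hY ht hA i) (M := (C * t).toNNReal)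
    ?_ fun u v huv => ?_
  · filter_upwards [hA] with ω hω
    refine Real.toNNReal_le_toNNReal ?_
    rw [hω.eq t ⟨ht, le_rfl⟩ i]
    refine (intervalIntegral.integral_mono_on ht (hω.integrable i)
      (intervalIntegrable_const (c := C)) fun s _ => hg.le _ _ _).trans_eq ?_
    simp [mul_comm]
  · obtain ⟨D, hD, h⟩ := exists_measurableSet_stoppedPaths hg hY ht hA i u
    have h1 : ∀ᵐ ω ∂μ, stoppedPaths Y i u ω ∈ Dᶜ ↔ u ≤ (A ω t i).toNNReal := by
      filter_upwards [h, hA] with ω hω hAω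
      rw [mem_compl_iff, hω, not_lt,
        Real.le_toNNReal_iff_coe_le (hAω.nonneg hg.nonneg ⟨ht, le_rfl⟩ i)]
    have hincr : Measurable fun ω => Y i v ω - Y i u ω :=
      ((hY i).measurable v).sub ((hY i).measurable u)
    have hcast : Measurable fun n : ℕ => (n : ℝ≥0∞) := measurable_of_countable _
    have hone : Measurable (Dᶜ.indicator (fun _ => (1 : ℝ≥0∞))) :=
      measurable_const.indicator hD.compl
    have hst := measurable_stoppedPaths hY i u
    have h2 := lintegral_mul_eq_lintegral_mul_lintegral_of_indepFun (hone.comp hst)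
      (hcast.comp hincr) ((indepFun_stoppedPaths_sub hY hind i huv).comp hone hcast)
    have h3 : ∫⁻ ω, (if u ≤ (A ω t i).toNNReal then ((Y i v ω - Y i u ω : ℕ) : ℝ≥0∞) else 0) ∂μ =
        ∫⁻ ω, ((Dᶜ.indicator (fun _ => (1 : ℝ≥0∞)) ∘ stoppedPaths Y i u) *
          ((fun n : ℕ => (n : ℝ≥0∞)) ∘ fun ω => Y i v ω - Y i u ω)) ω ∂μ := by
      refine lintegral_congr_ae ?_
      filter_upwards [h1] with ω hω
      simp only [Pi.mul_apply, Function.comp_apply, indicator_apply, hω]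
      split_ifs <;> simp
    have h4 : ∫⁻ ω, (Dᶜ.indicator (fun _ => (1 : ℝ≥0∞)) ∘ stoppedPaths Y i u) ω ∂μ =
        μ {ω | u ≤ (A ω t i).toNNReal} := by
      have h5 : (Dᶜ.indicator (fun _ => (1 : ℝ≥0∞)) ∘ stoppedPaths Y i u) =
          (stoppedPaths Y i u ⁻¹' Dᶜ).indicator 1 := rfl
      rw [h5, lintegral_indicator_one (hst hD.compl)]
      refine measure_congr ?_
      filter_upwards [h1] with ω hω
      exact propext hω
    rw [h3, h2, h4, ← (hY i).lintegral_sub huv]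
    rfl

end Bounded

/-! ### Grönwall's inequality -/

/-- The integral form of Grönwall's inequality, for functions which need not be measurable. -/
theorem lintegral_gronwall {φ : ℝ → ℝ≥0∞} {T : ℝ} {a M : ℝ≥0∞} {K : ℝ≥0}
    (hM : M ≠ ∞) (hφM : ∀ t ∈ Icc 0 T, φ t ≤ M)
    (hφ : ∀ t ∈ Icc 0 T, φ t ≤ a + ∫⁻ s in Ioc 0 t, K * φ s) :
    ∀ t ∈ Icc 0 T, φ t ≤ 2 * a * ENNReal.ofReal (Real.exp ((2 * K + 1) * t)) := by
  -- Chosen so that `K` times the integral of the weight `E` is at most half of `E`; the `+ 1` keeps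
  -- `lam` positive when `K = 0`.
  set lam : ℝ := 2 * K + 1 with hlam
  have hlampos : 0 < lam := by positivity
  let E : ℝ → ℝ≥0∞ := fun t => ENNReal.ofReal (Real.exp (lam * t))
  have hE0 : ∀ t, E t ≠ 0 := fun t => by simp [E, Real.exp_pos]
  have hEt : ∀ t, E t ≠ ∞ := fun t => ENNReal.ofReal_ne_top
  let S : ℝ≥0∞ := ⨆ t ∈ Icc 0 T, φ t / E t
  have hSφ : ∀ t ∈ Icc 0 T, φ t ≤ S * E t := fun t ht => by
    rw [← ENNReal.div_le_iff (hE0 t) (hEt t)]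
    exact le_iSup₂ (f := fun t (_ : t ∈ Icc 0 T) => φ t / E t) t ht
  have hE1 : ∀ t, 0 ≤ t → 1 ≤ E t := fun t ht => by
    simp only [E, ENNReal.one_le_ofReal]
    exact Real.one_le_exp (by positivity)
  -- The a priori bound `M` serves only here: finiteness allows `S / 2` to be cancelled in `S ≤ a +
  -- S / 2`.
  have hStop : S ≠ ∞ := by
    refine ne_top_of_le_ne_top hM (iSup₂_le fun t ht => ?_)
    exact ENNReal.div_le_of_le_mul ((hφM t ht).trans (le_mul_of_one_le_right' (hE1 t ht.1)))
  have hint : ∀ t, 0 ≤ t → (K : ℝ≥0∞) * ∫⁻ s in Ioc 0 t, E s ≤ E t / 2 := by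
    intro t ht
    have h1 : ∫⁻ s in Ioc 0 t, E s = ENNReal.ofReal (∫ s in (0 : ℝ)..t, Real.exp (lam * s)) := by
      rw [intervalIntegral.integral_of_le ht, ofReal_integral_eq_lintegral_ofReal]
      · exact (Continuous.integrableOn_Ioc (by fun_prop))
      · exact ae_of_all _ fun s => (Real.exp_pos _).le
    have h2 : ∫ s in (0 : ℝ)..t, Real.exp (lam * s) = (Real.exp (lam * t) - 1) / lam := by
      rw [intervalIntegral.integral_comp_mul_left _ hlampos.ne', integral_exp]
      simp [div_eq_inv_mul]
    rw [h1, h2, show (2 : ℝ≥0∞) = ENNReal.ofReal 2 by simp, ← ENNReal.ofReal_coe_nnreal,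
      ← ENNReal.ofReal_mul (by positivity)]
    simp only [E]
    rw [← ENNReal.ofReal_div_of_pos two_pos]
    refine ENNReal.ofReal_le_ofReal ?_
    rw [mul_div_assoc', div_le_div_iff₀ hlampos two_pos, hlam]
    have := Real.exp_pos ((2 * (K : ℝ) + 1) * t)
    nlinarith [K.2]
  have hstep : S ≤ a + S / 2 := by
    refine iSup₂_le fun t ht => ENNReal.div_le_of_le_mul ?_
    refine (hφ t ht).trans ?_
    rw [add_mul]
    refine add_le_add (le_mul_of_one_le_right' (hE1 t ht.1)) ?_
    calc ∫⁻ s in Ioc 0 t, K * φ s ≤ ∫⁻ s in Ioc 0 t, (K * S) * E s := by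
          refine setLIntegral_mono' measurableSet_Ioc fun s hs => ?_
          rw [mul_assoc]
          gcongr
          exact hSφ s ⟨hs.1.le, hs.2.trans ht.2⟩
      _ = S * (K * ∫⁻ s in Ioc 0 t, E s) := by
          rw [lintegral_const_mul _ (by fun_prop)]; ring
      _ ≤ S * (E t / 2) := by gcongr; exact hint t ht.1
      _ = S / 2 * E t := by simp only [div_eq_mul_inv]; ring
  have hS : S ≤ 2 * a := by
    have h1 : S / 2 + S / 2 ≤ a + S / 2 := by rwa [ENNReal.add_halves]
    have h2 : S / 2 ≤ a :=
      (ENNReal.add_le_add_iff_right (ENNReal.div_ne_top hStop two_ne_zero)).1 h1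
    calc S = 2 * (S / 2) := by rw [two_mul, ENNReal.add_halves]
      _ ≤ 2 * a := by gcongr
  intro t ht
  exact (hSφ t ht).trans (by gcongr)

/-! ### Joint measurability in time and randomness -/

section JointMeasurability

variable {Ω : Type*} [MeasurableSpace Ω] {μ : Measure Ω}

/-- A process on `[0, T]` with right-continuous paths in `ℕ` is jointly measurable. -/
lemma aemeasurable_uncurry_of_rightConst {T : ℝ} {F : ℝ → Ω → ℕ}
    (hT : 0 ≤ T) (hm : ∀ s ∈ Icc 0 T, AEMeasurable (F s) μ)
    (hF : ∀ᵐ ω ∂μ, ∀ s ∈ Ico 0 T, ∃ e ∈ Ioc s T, ∀ r ∈ Icc s e, F r ω = F s ω) :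
    AEMeasurable (fun p : ℝ × Ω => F p.1 p.2) ((volume.restrict (Icc 0 T)).prod μ) := by
  -- Each time is rounded up to the grid of mesh `1 / (n + 1)` and capped at `T`, so that sampling
  -- approaches it from the right within `[0, T]`.
  let σ : ℕ → ℕ → ℝ := fun n m => min (((m + 1 : ℕ) : ℝ) * (1 / (n + 1))) T
  have hσ : ∀ n m, σ n m ∈ Icc 0 T := fun n m => ⟨le_min (by positivity) hT, min_le_right _ _⟩
  let κ : ℕ → ℝ → ℕ := fun n s => ⌊s / (1 / (n + 1))⌋₊
  refine aemeasurable_of_tendsto_metrizable_ae atTop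
    (f := fun (n : ℕ) (p : ℝ × Ω) => F (σ n (κ n p.1)) p.2) (fun n => ?_) ?_
  -- For fixed `n` only the countably many times `σ n m` matter, so replacing `F` there by
  -- measurable versions costs one null set.
  · choose! G hG hG' using hm
    have h1 : Measurable fun p : ℕ × Ω => G (σ n p.1) p.2 :=
      measurable_from_prod_countable_right fun m => hG (σ n m) (hσ n m)
    have hκ : Measurable (κ n) := Nat.measurable_floor.comp (measurable_id.div_const _)
    refine ⟨fun p => G (σ n (κ n p.1)) p.2, h1.comp
      ((hκ.comp measurable_fst).prodMk measurable_snd), ?_⟩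
    have h2 : ∀ᵐ ω ∂μ, ∀ m, F (σ n m) ω = G (σ n m) ω :=
      ae_all_iff.2 fun m => hG' (σ n m) (hσ n m)
    filter_upwards [Measure.quasiMeasurePreserving_snd.ae h2] with p hp
    exact hp _
  · have hI : ∀ᵐ p ∂((volume.restrict (Icc 0 T)).prod μ), p.1 ∈ Icc 0 T :=
      Measure.quasiMeasurePreserving_fst.ae (ae_restrict_mem measurableSet_Icc)
    filter_upwards [Measure.quasiMeasurePreserving_snd.ae hF, hI] with p hp hpI
    have hle : ∀ n, p.1 ≤ σ n (κ n p.1) := fun n => by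
      refine le_min ?_ hpI.2
      have := Nat.lt_floor_add_one (p.1 / (1 / ((n : ℝ) + 1)))
      rw [div_lt_iff₀ (by positivity)] at this
      simp only [κ]
      exact_mod_cast this.le
    have hge : ∀ n, σ n (κ n p.1) ≤ p.1 + 1 / (n + 1) := fun n => by
      refine (min_le_left _ _).trans ?_
      have := Nat.floor_le (show 0 ≤ p.1 / (1 / ((n : ℝ) + 1)) from
        div_nonneg hpI.1 (by positivity))
      rw [le_div_iff₀ (by positivity)] at this
      push_cast
      rw [add_mul, one_mul]
      gcongr
    rcases hpI.2.lt_or_eq with hlt | heq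
    · obtain ⟨e, he, hconst⟩ := hp p.1 ⟨hpI.1, hlt⟩
      have hlim := tendsto_one_div_add_atTop_nhds_zero_nat (𝕜 := ℝ)
      have hev : ∀ᶠ n : ℕ in atTop, 1 / ((n : ℝ) + 1) < e - p.1 :=
        hlim.eventually_lt_const (sub_pos.2 he.1)
      refine tendsto_const_nhds.congr' (hev.mono fun n hn => ?_)
      exact (hconst _ ⟨hle n, (hge n).trans (by linarith)⟩).symm
    · refine tendsto_const_nhds.congr fun n => ?_
      rw [show σ n (κ n p.1) = p.1 from le_antisymm ((min_le_right _ _).trans_eq heq.symm) (hle n)]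

end JointMeasurability

/-! ### Restriction of clocks to shorter intervals and measurability in time -/

section Clock

variable {ι : Type*} {g : ι → ℝ → (ι → ℕ) → ℝ} {y : ι → ℝ → ℕ} {t T : ℝ} {A : ℝ → ι → ℝ}

lemma IsClock.mono (h : IsClock g y T A) (ht : t ∈ Icc 0 T) : IsClock g y t A :=
  ⟨fun i => h.intervalIntegrable ⟨le_rfl, ht.1.trans ht.2⟩ ht i,
    fun r hr i => h.eq r ⟨hr.1, hr.2.trans ht.2⟩ i⟩

lemma IsClock.count_monotoneOn (h : IsClock g y T A) (hg : ∀ i s c, 0 ≤ g i s c)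
    (hy : ∀ i, Monotone (y i)) (i : ι) : MonotoneOn (fun s => y i (A s i)) (Icc 0 T) :=
  fun _ ha _ hb hab => hy i (h.monotoneOn hg i ha hb hab)

/-- The numbers of events are measurable in time. -/
lemma IsClock.exists_measurable_count (h : IsClock g y T A) (hg : ∀ i s c, 0 ≤ g i s c)
    (hy : ∀ i, Monotone (y i)) :
    ∃ n : ℝ → ι → ℕ, Measurable n ∧ ∀ s ∈ Icc 0 T, (fun j => y j (A s j)) = n s := by
  rcases lt_or_ge T 0 with hT | hT
  · exact ⟨0, measurable_const, fun s hs => absurd (hs.1.trans hs.2) (not_le.2 hT)⟩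
  · refine ⟨fun s j => y j (A (projIcc 0 T hT s) j), measurable_pi_lambda _ fun j => ?_,
      fun s hs => ?_⟩
    · refine Monotone.measurable fun a b hab => ?_
      exact h.count_monotoneOn hg hy j (projIcc 0 T hT a).2 (projIcc 0 T hT b).2
        (monotone_projIcc hT hab)
    · simp only [projIcc_of_mem hT hs]

end Clock

/-! ### Truncation after `n` events -/

/-- Measurable nonnegative rates growing at most linearly in the number of events. -/
structure IsLinearGrowthRate {ι : Type*} [Fintype ι] (g : ι → ℝ → (ι → ℕ) → ℝ) (C : ℝ≥0) :
    Prop where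
  measurable : ∀ i, Measurable (fun p : ℝ × (ι → ℕ) => g i p.1 p.2)
  nonneg : ∀ i s c, 0 ≤ g i s c
  le : ∀ i s c, g i s c ≤ C * (1 + ∑ j, c j : ℕ)

/-- The rates `g`, switched off as soon as `n` events have taken place. -/
def truncRate {ι : Type*} [Fintype ι] (g : ι → ℝ → (ι → ℕ) → ℝ) (n : ℕ) (i : ι) (s : ℝ)
    (c : ι → ℕ) : ℝ :=
  if ∑ j, c j < n then g i s c else 0

section Truncation

variable {ι : Type*} [Fintype ι] {g : ι → ℝ → (ι → ℕ) → ℝ} {C : ℝ≥0} {y : ι → ℝ → ℕ} {T : ℝ}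
  {A : ℝ → ι → ℝ}

lemma IsLinearGrowthRate.trunc (hg : IsLinearGrowthRate g C) (n : ℕ) :
    IsLinearGrowthRate (truncRate g n) C where
  measurable i := by
    refine Measurable.ite ?_ (hg.measurable i) measurable_const
    have : Measurable fun c : ι → ℕ => ∑ j, c j := measurable_of_countable _
    exact measurableSet_lt (this.comp measurable_snd) measurable_const
  nonneg i s c := by
    unfold truncRate
    split_ifs
    · exact hg.nonneg i s c
    · exact le_rfl
  le i s c := by
    unfold truncRate
    split_ifs
    · exact hg.le i s c
    · positivity

lemma IsLinearGrowthRate.trunc_bounded (hg : IsLinearGrowthRate g C) (n : ℕ) :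
    IsBoundedRate (truncRate g n) (C * (1 + n)) where
  measurable := (hg.trunc n).measurable
  nonneg := (hg.trunc n).nonneg
  le i s c := by
    unfold truncRate
    split_ifs with h
    · refine (hg.le i s c).trans ?_
      push_cast
      gcongr
      exact_mod_cast h.le
    · positivity

/-- The clocks stopped when the number of events reaches `n`. -/
noncomputable def truncClock (g : ι → ℝ → (ι → ℕ) → ℝ) (y : ι → ℝ → ℕ) (A : ℝ → ι → ℝ) (n : ℕ)
    (r : ℝ) (i : ι) : ℝ :=
  ∫ s in 0..r, truncRate g n i s (fun j => y j (A s j))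

lemma IsClock.trunc_intervalIntegrable (hA : IsClock g y T A) (hg : IsLinearGrowthRate g C)
    (hy : ∀ i, Monotone (y i)) (n : ℕ) (i : ι) {a b : ℝ} (ha : a ∈ Icc 0 T) (hb : b ∈ Icc 0 T) :
    IntervalIntegrable (fun s => truncRate g n i s (fun j => y j (A s j))) volume a b := by
  obtain ⟨m, hm, hmeq⟩ := hA.exists_measurable_count hg.nonneg hy
  refine ((hg.trunc_bounded n).intervalIntegrable i hm a b).congr fun s hs => ?_
  have : s ∈ Icc 0 T := uIcc_subset_Icc ha hb (uIoc_subset_uIcc hs)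
  simp only [hmeq s this]

/-- The bound is required only strictly before `r`, so the lemma also covers the instant at which
the count reaches `n`; a single time does not affect the integral. -/
lemma truncClock_eq_of_lt (hA : IsClock g y T A) {n : ℕ} {r : ℝ} (hr : r ∈ Icc 0 T)
    (hlt : ∀ s ∈ Ico 0 r, ∑ j, y j (A s j) < n) : truncClock g y A n r = A r := by
  ext i
  rw [hA.eq r hr i, truncClock]
  refine intervalIntegral.integral_congr_ae ?_
  have : ∀ᵐ s ∂(volume : Measure ℝ), s ≠ r := Measure.ae_ne volume r
  filter_upwards [this] with s hsr hs
  rw [uIoc_of_le hr.1] at hs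
  rw [truncRate, if_pos (hlt s ⟨hs.1.le, lt_of_le_of_ne hs.2 hsr⟩)]

lemma IsClock.sum_count_mono (hA : IsClock g y T A) (hg : IsLinearGrowthRate g C)
    (hy : ∀ i, Monotone (y i)) {a b : ℝ} (ha : a ∈ Icc 0 T) (hb : b ∈ Icc 0 T) (hab : a ≤ b) :
    ∑ j, y j (A a j) ≤ ∑ j, y j (A b j) :=
  Finset.sum_le_sum fun j _ => hA.count_monotoneOn hg.nonneg hy j ha hb hab

lemma truncClock_eq (hA : IsClock g y T A) (hg : IsLinearGrowthRate g C)
    (hy : ∀ i, Monotone (y i)) {n : ℕ} {r : ℝ} (hr : r ∈ Icc 0 T)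
    (hlt : ∑ j, y j (A r j) < n) : truncClock g y A n r = A r :=
  truncClock_eq_of_lt hA hr fun _ hs =>
    (hA.sum_count_mono hg hy ⟨hs.1, hs.2.le.trans hr.2⟩ hr hs.2.le).trans_lt hlt

lemma truncClock_monotoneOn (hA : IsClock g y T A) (hg : IsLinearGrowthRate g C)
    (hy : ∀ i, Monotone (y i)) (n : ℕ) (i : ι) :
    MonotoneOn (fun r => truncClock g y A n r i) (Icc 0 T) := by
  intro a ha b hb hab
  have h0 : (0 : ℝ) ∈ Icc 0 T := ⟨le_rfl, ha.1.trans ha.2⟩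
  have h1 := intervalIntegral.integral_interval_sub_left
    (hA.trunc_intervalIntegrable hg hy n i h0 hb) (hA.trunc_intervalIntegrable hg hy n i h0 ha)
  have h2 : 0 ≤ ∫ s in a..b, truncRate g n i s (fun j => y j (A s j)) :=
    intervalIntegral.integral_nonneg hab fun _ _ => (hg.trunc n).nonneg _ _ _
  simp only [truncClock]
  linarith

/-- The number of events seen by the stopped clocks reaches `n` when the original one does. -/
lemma le_sum_truncClock (hA : IsClock g y T A) (hg : IsLinearGrowthRate g C)
    (hy : ∀ i, Monotone (y i)) (hy' : ∀ i, RightConst (y i)) {n : ℕ} {r : ℝ} (hr : r ∈ Icc 0 T)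
    (hn : n ≤ ∑ j, y j (A r j)) : n ≤ ∑ j, y j (truncClock g y A n r j) := by
  let S : Set ℝ := {s | s ∈ Icc 0 r ∧ n ≤ ∑ j, y j (A s j)}
  have hrS : r ∈ S := ⟨⟨hr.1, le_rfl⟩, hn⟩
  have hbdd : BddBelow S := ⟨0, fun s hs => hs.1.1⟩
  let σ := sInf S
  have hσr : σ ≤ r := csInf_le hbdd hrS
  have hσ0 : 0 ≤ σ := le_csInf ⟨r, hrS⟩ fun s hs => hs.1.1
  have hσI : σ ∈ Icc 0 T := ⟨hσ0, hσr.trans hr.2⟩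
  have hbelow : ∀ s ∈ Ico 0 σ, ∑ j, y j (A s j) < n := by
    intro s hs
    by_contra! hcon
    exact (notMem_of_lt_csInf hs.2 hbdd) ⟨⟨hs.1, hs.2.le.trans hσr⟩, hcon⟩
  -- The infimum is attained: counts are constant just to the right of `σ`, where points of `S`
  -- accumulate if `σ < r`.
  have hσn : n ≤ ∑ j, y j (A σ j) := by
    rcases hσr.lt_or_eq with hlt | heq
    · obtain ⟨e, he, hconst⟩ := hA.exists_right_const hg.nonneg hy' ⟨hσ0, hlt.trans_le hr.2⟩
      obtain ⟨s, hs, hse⟩ := exists_lt_of_csInf_lt ⟨r, hrS⟩ he.1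
      have hσs : σ ≤ s := csInf_le hbdd hs
      refine hs.2.trans_eq (Finset.sum_congr rfl fun j _ => ?_)
      exact hconst s ⟨hσs, hse.le⟩ j
    · rwa [heq]
  rw [← truncClock_eq_of_lt hA hσI hbelow] at hσn
  exact hσn.trans (Finset.sum_le_sum fun j _ =>
    hy j (truncClock_monotoneOn hA hg hy n j hσI hr hσr))

/-- While the count is below `n` the truncated and original clocks agree. Afterwards the count seen
by the truncated clocks is also at least `n`, so the truncated rates vanish in either reading. -/
lemma isClock_truncClock (hA : IsClock g y T A) (hg : IsLinearGrowthRate g C)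
    (hy : ∀ i, Monotone (y i)) (hy' : ∀ i, RightConst (y i)) (hT : 0 ≤ T)
    (n : ℕ) : IsClock (truncRate g n) y T (truncClock g y A n) := by
  have key : ∀ s ∈ Icc 0 T, ∀ i, truncRate g n i s (fun j => y j (A s j)) =
      truncRate g n i s (fun j => y j (truncClock g y A n s j)) := by
    intro s hs i
    by_cases h : ∑ j, y j (A s j) < n
    · rw [truncClock_eq hA hg hy hs h]
    · have h2 := le_sum_truncClock hA hg hy hy' hs (not_lt.1 h)
      rw [truncRate, truncRate, if_neg h, if_neg (not_lt.2 h2)]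
  refine ⟨fun i => ?_, fun r hr i => ?_⟩
  · refine (hA.trunc_intervalIntegrable hg hy n i ⟨le_rfl, hT⟩ ⟨hT, le_rfl⟩).congr fun s hs => ?_
    rw [uIoc_of_le hT] at hs
    exact key s ⟨hs.1.le, hs.2⟩ i
  · rw [truncClock]
    refine intervalIntegral.integral_congr fun s hs => ?_
    rw [uIcc_of_le hr.1] at hs
    exact key s ⟨hs.1, hs.2.trans hr.2⟩ i

lemma truncClock_mono (hA : IsClock g y T A) (hg : IsLinearGrowthRate g C)
    (hy : ∀ i, Monotone (y i)) {r : ℝ} (hr : r ∈ Icc 0 T) (i : ι) :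
    Monotone fun n => truncClock g y A n r i := by
  intro a b hab
  have h0 : (0 : ℝ) ∈ Icc 0 T := ⟨le_rfl, hr.1.trans hr.2⟩
  refine intervalIntegral.integral_mono_on hr.1 (hA.trunc_intervalIntegrable hg hy a i h0 hr)
    (hA.trunc_intervalIntegrable hg hy b i h0 hr) fun s _ => ?_
  unfold truncRate
  split_ifs with h1 h2
  · exact le_rfl
  · omega
  · exact hg.nonneg _ _ _
  · exact le_rfl

end Truncation

/-! ### Mean number of events and removal of the truncation -/

section Expectation

variable {Ω : Type*} [MeasurableSpace Ω] {μ : Measure Ω}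
  {ι : Type*} [Fintype ι] {g : ι → ℝ → (ι → ℕ) → ℝ} {C : ℝ≥0} {B : ℝ}
  {Y : ι → ℝ≥0 → Ω → ℕ} {T : ℝ} {A : Ω → ℝ → ι → ℝ}

lemma measurable_natCast_ennreal : Measurable fun n : ℕ => (n : ℝ≥0∞) := measurable_of_countable _

/-- Joint measurability of the number of events in time and randomness. -/
lemma aemeasurable_count (hY : ∀ i, IsUnitPoissonProcess μ (Y i)) (hT : 0 ≤ T)
    (hg : ∀ i s c, 0 ≤ g i s c)
    (hA : ∀ᵐ ω ∂μ, IsClock g (fun j a => Y j a.toNNReal ω) T (A ω))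
    (hm : ∀ s ∈ Icc 0 T, ∀ i, AEMeasurable (fun ω => (A ω s i).toNNReal) μ) (i : ι) :
    AEMeasurable (fun p : ℝ × Ω => Y i (A p.2 p.1 i).toNNReal p.2)
      ((volume.restrict (Icc 0 T)).prod μ) := by
  refine aemeasurable_uncurry_of_rightConst (F := fun s ω => Y i (A ω s i).toNNReal ω) hT
    (fun s hs => aemeasurable_eval (hY i) (hm s hs i)) ?_
  filter_upwards [hA, ae_all_iff.2 fun j => (hY j).paths] with ω hω hp s hs
  obtain ⟨e, he, h⟩ := hω.exists_right_const hg (fun j => rightConst_toNNReal (hp j).2) hs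
  exact ⟨e, he, fun r hr => h r hr i⟩

/-- The bound for the mean number of events. -/
noncomputable def eventBound (ι : Type*) [Fintype ι] (C : ℝ≥0) (T : ℝ) : ℝ≥0∞ :=
  2 * (Fintype.card ι * C * ENNReal.ofReal T) *
    ENNReal.ofReal (Real.exp ((2 * (Fintype.card ι * C : ℝ≥0) + 1) * T))

lemma eventBound_ne_top (C : ℝ≥0) (T : ℝ) : eventBound ι C T ≠ ∞ := by
  unfold eventBound
  finiteness

/-- Wald's identity turns linear growth of the rates into a linear integral inequality for the mean
count. The bound `B` only makes that mean finite; since it is absent from the result, the estimate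
is uniform over truncations. -/
theorem lintegral_sum_count_le_of_bounded [IsProbabilityMeasure μ]
    (hg : IsLinearGrowthRate g C) (hgB : IsBoundedRate g B)
    (hY : ∀ i, IsUnitPoissonProcess μ (Y i)) (hind : iIndepFun (fun i ω t => Y i t ω) μ)
    (hA : ∀ᵐ ω ∂μ, IsClock g (fun j a => Y j a.toNNReal ω) T (A ω)) :
    ∀ t ∈ Icc 0 T, ∫⁻ ω, ((∑ j, Y j (A ω t j).toNNReal ω : ℕ) : ℝ≥0∞) ∂μ ≤ eventBound ι C T := by
  intro t₀ ht₀
  have hT : 0 ≤ T := ht₀.1.trans ht₀.2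
  have hAt : ∀ t ∈ Icc 0 T, ∀ᵐ ω ∂μ, IsClock g (fun j a => Y j a.toNNReal ω) t (A ω) :=
    fun t ht => hA.mono fun ω hω => hω.mono ht
  have hm : ∀ s ∈ Icc 0 T, ∀ i, AEMeasurable (fun ω => (A ω s i).toNNReal) μ :=
    fun s hs i => hgB.aemeasurable_clock hY hs.1 (hAt s hs) i
  let N : ℝ → Ω → ℕ := fun t ω => ∑ j, Y j (A ω t j).toNNReal ω
  let φ : ℝ → ℝ≥0∞ := fun t => ∫⁻ ω, (N t ω : ℝ≥0∞) ∂μ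
  have hφeq : ∀ t ∈ Icc 0 T, φ t = ∑ j, ∫⁻ ω, ENNReal.ofReal (A ω t j) ∂μ := by
    intro t ht
    simp only [φ, N, Nat.cast_sum]
    rw [lintegral_finsetSum' (f := fun j ω => (Y j (A ω t j).toNNReal ω : ℝ≥0∞)) _
      fun j _ => measurable_natCast_ennreal.comp_aemeasurable (aemeasurable_eval (hY j) (hm t ht j))]
    exact Finset.sum_congr rfl fun j _ => hgB.lintegral_clock_eq hY hind ht.1 (hAt t ht) j
  have hNm : AEMeasurable (fun p : ℝ × Ω => (N p.1 p.2 : ℝ≥0∞))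
      ((volume.restrict (Icc 0 T)).prod μ) := by
    refine measurable_natCast_ennreal.comp_aemeasurable ?_
    exact Finset.aemeasurable_fun_sum _ fun j _ => aemeasurable_count hY hT hg.nonneg hA hm j
  have hAle : ∀ t ∈ Icc 0 T, ∀ j, ∫⁻ ω, ENNReal.ofReal (A ω t j) ∂μ ≤
      ∫⁻ s in Ioc 0 t, C * (1 + φ s) := by
    intro t ht j
    have h1 : ∀ᵐ ω ∂μ, ENNReal.ofReal (A ω t j) ≤ ∫⁻ s in Ioc 0 t, C * (1 + (N s ω : ℝ≥0∞)) := by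
      filter_upwards [hA] with ω hω
      rw [hω.eq t ht j, intervalIntegral.integral_of_le ht.1,
        ofReal_integral_eq_lintegral_ofReal ((intervalIntegrable_iff_integrableOn_Ioc_of_le ht.1).1
          ((hω.mono ht).integrable j)) (ae_of_all _ fun s => hg.nonneg _ _ _)]
      refine lintegral_mono fun s => ENNReal.ofReal_le_of_le_toReal ?_
      refine (hg.le j s _).trans_eq ?_
      simp only [N]
      rw [← Nat.cast_one (R := ℝ≥0∞), ← Nat.cast_add, ENNReal.toReal_mul, ENNReal.toReal_natCast,
        ENNReal.coe_toReal]
    refine (lintegral_mono_ae h1).trans_eq ?_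
    have hsub : Ioc 0 t ⊆ Icc 0 T := fun s hs => ⟨hs.1.le, hs.2.trans ht.2⟩
    have hNt : AEMeasurable (fun p : ℝ × Ω => (N p.1 p.2 : ℝ≥0∞))
        ((volume.restrict (Ioc 0 t)).prod μ) :=
      hNm.mono_ac ((Measure.absolutelyContinuous_of_le
        (Measure.restrict_mono hsub le_rfl)).prod .rfl)
    rw [← lintegral_lintegral_swap (f := fun s ω => C * (1 + (N s ω : ℝ≥0∞)))
      ((hNt.const_add 1).const_mul _)]
    refine lintegral_congr fun s => ?_
    rw [lintegral_const_mul' _ _ ENNReal.coe_ne_top, lintegral_add_left measurable_const]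
    simp [φ]
  -- Each of the `card ι` clocks contributes `∫ C * (1 + φ)`: the constant part gives `a`, the part
  -- in `φ` gives `K`.
  have hgron := lintegral_gronwall (φ := φ) (T := T) (a := Fintype.card ι * C * ENNReal.ofReal T)
    (M := Fintype.card ι * ENNReal.ofReal (B * T)) (K := Fintype.card ι * C) ?_ ?_ ?_ t₀ ht₀
  · refine hgron.trans ?_
    unfold eventBound
    gcongr
    exact ht₀.2
  · finiteness
  · intro t ht
    rw [hφeq t ht]
    refine (Finset.sum_le_card_nsmul _ _ (ENNReal.ofReal (B * T)) fun j _ => ?_).trans_eq ?_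
    · have h1 : ∀ᵐ ω ∂μ, ENNReal.ofReal (A ω t j) ≤ ENNReal.ofReal (B * T) := by
        filter_upwards [hA] with ω hω
        refine ENNReal.ofReal_le_ofReal ((hω.monotoneOn hg.nonneg j ht ⟨hT, le_rfl⟩ ht.2).trans ?_)
        simp only
        rw [hω.eq T ⟨hT, le_rfl⟩ j]
        refine (intervalIntegral.integral_mono_on hT (hω.integrable j)
          (intervalIntegrable_const (c := B)) fun s _ => hgB.le _ _ _).trans_eq ?_
        simp [mul_comm]
      refine (lintegral_mono_ae h1).trans_eq ?_
      simp
    · simp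
  · intro t ht
    rw [hφeq t ht]
    refine (Finset.sum_le_card_nsmul _ _ _ fun j _ => hAle t ht j).trans ?_
    rw [nsmul_eq_mul, Finset.card_univ, ← lintegral_const_mul' _ _ (by finiteness)]
    have h1 : ∀ s, (Fintype.card ι : ℝ≥0∞) * (C * (1 + φ s)) =
        Fintype.card ι * C + (Fintype.card ι * C : ℝ≥0) * φ s := fun s => by
      push_cast; ring
    rw [lintegral_congr h1, lintegral_add_left measurable_const]
    gcongr
    rw [lintegral_const, Measure.restrict_apply_univ, Real.volume_Ioc, sub_zero]
    gcongr
    exact ht.2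

lemma tendsto_truncClock (hg : IsLinearGrowthRate g C) (hY : ∀ i, IsUnitPoissonProcess μ (Y i))
    (hA : ∀ᵐ ω ∂μ, IsClock g (fun j a => Y j a.toNNReal ω) T (A ω)) {t : ℝ} (ht : t ∈ Icc 0 T) :
    ∀ᵐ ω ∂μ, ∀ᶠ n in atTop, truncClock g (fun j a => Y j a.toNNReal ω) (A ω) n t = A ω t := by
  filter_upwards [hA, ae_all_iff.2 fun j => (hY j).paths] with ω hω hp
  filter_upwards [eventually_gt_atTop (∑ j, Y j (A ω t j).toNNReal ω)] with n hn
  exact truncClock_eq hω hg (fun j a b hab => (hp j).1 (Real.toNNReal_le_toNNReal hab)) ht hn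

lemma ae_isClock_truncClock (hg : IsLinearGrowthRate g C)
    (hY : ∀ i, IsUnitPoissonProcess μ (Y i))
    (hA : ∀ᵐ ω ∂μ, IsClock g (fun j a => Y j a.toNNReal ω) T (A ω)) (hT : 0 ≤ T) (n : ℕ) :
    ∀ᵐ ω ∂μ, IsClock (truncRate g n) (fun j a => Y j a.toNNReal ω) T
      (truncClock g (fun j a => Y j a.toNNReal ω) (A ω) n) := by
  filter_upwards [hA, ae_all_iff.2 fun j => (hY j).paths] with ω hω hp
  exact isClock_truncClock hω hg (fun j a b hab => (hp j).1 (Real.toNNReal_le_toNNReal hab))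
    (fun j => rightConst_toNNReal (hp j).2) hT n

lemma ae_truncClock_mono (hg : IsLinearGrowthRate g C) (hY : ∀ i, IsUnitPoissonProcess μ (Y i))
    (hA : ∀ᵐ ω ∂μ, IsClock g (fun j a => Y j a.toNNReal ω) T (A ω)) {t : ℝ} (ht : t ∈ Icc 0 T) :
    ∀ᵐ ω ∂μ, ∀ i, Monotone fun n => truncClock g (fun j a => Y j a.toNNReal ω) (A ω) n t i := by
  filter_upwards [hA, ae_all_iff.2 fun j => (hY j).paths] with ω hω hp i
  exact truncClock_mono hω hg (fun j a b hab => (hp j).1 (Real.toNNReal_le_toNNReal hab)) ht i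

lemma aemeasurable_truncClock (hg : IsLinearGrowthRate g C)
    (hY : ∀ i, IsUnitPoissonProcess μ (Y i))
    (hA : ∀ᵐ ω ∂μ, IsClock g (fun j a => Y j a.toNNReal ω) T (A ω)) {t : ℝ} (ht : t ∈ Icc 0 T)
    (i : ι) (n : ℕ) : AEMeasurable
      (fun ω => (truncClock g (fun j a => Y j a.toNNReal ω) (A ω) n t i).toNNReal) μ :=
  (hg.trunc_bounded n).aemeasurable_clock hY ht.1
    ((ae_isClock_truncClock hg hY hA (ht.1.trans ht.2) n).mono fun _ h => h.mono ht) i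

lemma IsLinearGrowthRate.aemeasurable_clock (hg : IsLinearGrowthRate g C)
    (hY : ∀ i, IsUnitPoissonProcess μ (Y i))
    (hA : ∀ᵐ ω ∂μ, IsClock g (fun j a => Y j a.toNNReal ω) T (A ω)) {t : ℝ} (ht : t ∈ Icc 0 T)
    (i : ι) : AEMeasurable (fun ω => (A ω t i).toNNReal) μ := by
  refine aemeasurable_of_tendsto_metrizable_ae atTop (aemeasurable_truncClock hg hY hA ht i) ?_
  filter_upwards [tendsto_truncClock hg hY hA ht] with ω hω
  exact tendsto_const_nhds.congr' (hω.mono fun n hn => by simp only [hn])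

/-- Monotone convergence in the truncation level on both sides of the bounded identity: the
truncated clocks increase with `n` and almost surely equal `A` from some `n` on. -/
theorem IsLinearGrowthRate.lintegral_clock_eq [IsProbabilityMeasure μ]
    (hg : IsLinearGrowthRate g C)
    (hY : ∀ i, IsUnitPoissonProcess μ (Y i)) (hind : iIndepFun (fun i ω t => Y i t ω) μ)
    (hA : ∀ᵐ ω ∂μ, IsClock g (fun j a => Y j a.toNNReal ω) T (A ω)) {t : ℝ} (ht : t ∈ Icc 0 T)
    (i : ι) :
    ∫⁻ ω, (Y i (A ω t i).toNNReal ω : ℝ≥0∞) ∂μ = ∫⁻ ω, ENNReal.ofReal (A ω t i) ∂μ := by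
  let An : ℕ → Ω → ℝ := fun n ω => truncClock g (fun j a => Y j a.toNNReal ω) (A ω) n t i
  have hm : ∀ n, AEMeasurable (fun ω => (An n ω).toNNReal) μ :=
    aemeasurable_truncClock hg hY hA ht i
  have lim1 : Tendsto (fun n => ∫⁻ ω, (Y i (An n ω).toNNReal ω : ℝ≥0∞) ∂μ) atTop
      (𝓝 (∫⁻ ω, (Y i (A ω t i).toNNReal ω : ℝ≥0∞) ∂μ)) := by
    refine lintegral_tendsto_of_tendsto_of_monotone
      (fun n => measurable_natCast_ennreal.comp_aemeasurable (aemeasurable_eval (hY i) (hm n))) ?_ ?_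
    · filter_upwards [ae_truncClock_mono hg hY hA ht, (hY i).paths] with ω hω hp a b hab
      exact Nat.cast_le.2 (hp.1 (Real.toNNReal_le_toNNReal (hω i hab)))
    · filter_upwards [tendsto_truncClock hg hY hA ht] with ω hω
      exact tendsto_const_nhds.congr' (hω.mono fun n hn => by simp only [An, hn])
  have lim2 : Tendsto (fun n => ∫⁻ ω, ENNReal.ofReal (An n ω) ∂μ) atTop
      (𝓝 (∫⁻ ω, ENNReal.ofReal (A ω t i) ∂μ)) := by
    refine lintegral_tendsto_of_tendsto_of_monotone (fun n => (hm n).coe_nnreal_ennreal) ?_ ?_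
    · filter_upwards [ae_truncClock_mono hg hY hA ht] with ω hω a b hab
      exact ENNReal.ofReal_le_ofReal (hω i hab)
    · filter_upwards [tendsto_truncClock hg hY hA ht] with ω hω
      exact tendsto_const_nhds.congr' (hω.mono fun n hn => by simp only [An, hn])
  refine tendsto_nhds_unique lim1 (lim2.congr fun n => ?_)
  exact ((hg.trunc_bounded n).lintegral_clock_eq hY hind ht.1
    ((ae_isClock_truncClock hg hY hA (ht.1.trans ht.2) n).mono fun _ h => h.mono ht) i).symm

theorem IsLinearGrowthRate.lintegral_sum_count_le [IsProbabilityMeasure μ]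
    (hg : IsLinearGrowthRate g C)
    (hY : ∀ i, IsUnitPoissonProcess μ (Y i)) (hind : iIndepFun (fun i ω t => Y i t ω) μ)
    (hA : ∀ᵐ ω ∂μ, IsClock g (fun j a => Y j a.toNNReal ω) T (A ω)) {t : ℝ} (ht : t ∈ Icc 0 T) :
    ∫⁻ ω, ((∑ j, Y j (A ω t j).toNNReal ω : ℕ) : ℝ≥0∞) ∂μ ≤ eventBound ι C T := by
  let An : ℕ → Ω → ι → ℝ := fun n ω => truncClock g (fun j a => Y j a.toNNReal ω) (A ω) n t
  have lim : Tendsto (fun n => ∫⁻ ω, ((∑ j, Y j (An n ω j).toNNReal ω : ℕ) : ℝ≥0∞) ∂μ) atTop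
      (𝓝 (∫⁻ ω, ((∑ j, Y j (A ω t j).toNNReal ω : ℕ) : ℝ≥0∞) ∂μ)) := by
    refine lintegral_tendsto_of_tendsto_of_monotone
      (fun n => measurable_natCast_ennreal.comp_aemeasurable (Finset.aemeasurable_fun_sum _ fun j _ =>
        aemeasurable_eval (hY j) (aemeasurable_truncClock hg hY hA ht j n))) ?_ ?_
    · filter_upwards [ae_truncClock_mono hg hY hA ht, ae_all_iff.2 fun j => (hY j).paths]
        with ω hω hp a b hab
      exact Nat.cast_le.2 (Finset.sum_le_sum fun j _ =>
        (hp j).1 (Real.toNNReal_le_toNNReal (hω j hab)))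
    · filter_upwards [tendsto_truncClock hg hY hA ht] with ω hω
      exact tendsto_const_nhds.congr' (hω.mono fun n hn => by simp only [An, hn])
  refine le_of_tendsto' lim fun n => ?_
  exact lintegral_sum_count_le_of_bounded (hg.trunc n) (hg.trunc_bounded n) hY hind
    (ae_isClock_truncClock hg hY hA (ht.1.trans ht.2) n) t ht

end Expectation

/-! ### Integrability of the rates, and exchange of mean and time integral -/

section Fubini

variable {Ω : Type*} [MeasurableSpace Ω] {μ : Measure Ω} [IsProbabilityMeasure μ]
  {ι : Type*} [Fintype ι] {g : ι → ℝ → (ι → ℕ) → ℝ} {C : ℝ≥0}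
  {Y : ι → ℝ≥0 → Ω → ℕ} {T : ℝ} {A : Ω → ℝ → ι → ℝ}

/-- Linear growth reduces this to the mean count, which is bounded uniformly over the finite time
interval. -/
theorem IsLinearGrowthRate.integrable_rate_prod (hg : IsLinearGrowthRate g C)
    (hY : ∀ i, IsUnitPoissonProcess μ (Y i)) (hind : iIndepFun (fun i ω t => Y i t ω) μ)
    (hT : 0 ≤ T) (hA : ∀ᵐ ω ∂μ, IsClock g (fun j a => Y j a.toNNReal ω) T (A ω)) (i : ι) :
    Integrable (fun p : ℝ × Ω => g i p.1 (fun j => Y j (A p.2 p.1 j).toNNReal p.2))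
      ((volume.restrict (Icc 0 T)).prod μ) := by
  have hN : ∀ j, AEMeasurable (fun p : ℝ × Ω => Y j (A p.2 p.1 j).toNNReal p.2)
      ((volume.restrict (Icc 0 T)).prod μ) :=
    aemeasurable_count hY hT hg.nonneg hA fun s hs j => hg.aemeasurable_clock hY hA hs j
  have hm : AEMeasurable (fun p : ℝ × Ω => g i p.1 (fun j => Y j (A p.2 p.1 j).toNNReal p.2))
      ((volume.restrict (Icc 0 T)).prod μ) :=
    (hg.measurable i).comp_aemeasurable 
      (measurable_fst.aemeasurable.prodMk (aemeasurable_pi_lambda _ hN))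
  refine ⟨hm.aestronglyMeasurable, ?_⟩
  rw [hasFiniteIntegral_iff_enorm, lintegral_prod _ hm.enorm]
  have h1 : ∀ s ∈ Icc 0 T, ∫⁻ ω, ‖g i s (fun j => Y j (A ω s j).toNNReal ω)‖ₑ ∂μ ≤
      C * (1 + eventBound ι C T) := by
    intro s hs
    calc ∫⁻ ω, ‖g i s (fun j => Y j (A ω s j).toNNReal ω)‖ₑ ∂μ
        ≤ ∫⁻ ω, C * (1 + ((∑ j, Y j (A ω s j).toNNReal ω : ℕ) : ℝ≥0∞)) ∂μ := by
          refine lintegral_mono fun ω => ?_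
          rw [Real.enorm_of_nonneg (hg.nonneg _ _ _)]
          refine ENNReal.ofReal_le_of_le_toReal ((hg.le i s _).trans_eq ?_)
          rw [← Nat.cast_one (R := ℝ≥0∞), ← Nat.cast_add, ENNReal.toReal_mul,
            ENNReal.toReal_natCast, ENNReal.coe_toReal]
      _ = C * (1 + ∫⁻ ω, ((∑ j, Y j (A ω s j).toNNReal ω : ℕ) : ℝ≥0∞) ∂μ) := by
          rw [lintegral_const_mul' _ _ ENNReal.coe_ne_top, lintegral_add_left measurable_const]
          simp
      _ ≤ C * (1 + eventBound ι C T) := by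
          gcongr
          exact hg.lintegral_sum_count_le hY hind hA hs
  refine (setLIntegral_mono' measurableSet_Icc h1).trans_lt ?_
  have := eventBound_ne_top (ι := ι) C T
  rw [lintegral_const, Measure.restrict_apply_univ, Real.volume_Icc]
  finiteness

lemma IsLinearGrowthRate.intervalIntegrable_mean_rate (hg : IsLinearGrowthRate g C)
    (hY : ∀ i, IsUnitPoissonProcess μ (Y i)) (hind : iIndepFun (fun i ω t => Y i t ω) μ)
    (hT : 0 ≤ T) (hA : ∀ᵐ ω ∂μ, IsClock g (fun j a => Y j a.toNNReal ω) T (A ω)) (i : ι) :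
    IntervalIntegrable (fun s => ∫ ω, g i s (fun j => Y j (A ω s j).toNNReal ω) ∂μ)
      volume 0 T := by
  rw [intervalIntegrable_iff_integrableOn_Icc_of_le hT]
  exact (hg.integrable_rate_prod hY hind hT hA i).integral_prod_left

lemma IsLinearGrowthRate.integrable_count (hg : IsLinearGrowthRate g C)
    (hY : ∀ i, IsUnitPoissonProcess μ (Y i)) (hind : iIndepFun (fun i ω t => Y i t ω) μ)
    (hA : ∀ᵐ ω ∂μ, IsClock g (fun j a => Y j a.toNNReal ω) T (A ω)) {t : ℝ} (ht : t ∈ Icc 0 T)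
    (i : ι) : Integrable (fun ω => (Y i (A ω t i).toNNReal ω : ℝ)) μ := by
  have hm := aemeasurable_eval (hY i) (hg.aemeasurable_clock hY hA ht i)
  have hcast : Measurable fun n : ℕ => (n : ℝ) := measurable_of_countable _
  refine ⟨(hcast.comp_aemeasurable hm).aestronglyMeasurable, ?_⟩
  rw [hasFiniteIntegral_iff_enorm]
  refine lt_of_le_of_lt ?_ (lt_top_iff_ne_top.2 (eventBound_ne_top (ι := ι) C T))
  refine le_trans (lintegral_mono fun ω => ?_) (hg.lintegral_sum_count_le hY hind hA ht)
  rw [Real.enorm_of_nonneg (by positivity), ENNReal.ofReal_natCast]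
  exact Nat.cast_le.2 (Finset.single_le_sum (f := fun j => Y j (A ω t j).toNNReal ω)
    (fun _ _ => Nat.zero_le _) (Finset.mem_univ i))

theorem IsLinearGrowthRate.integral_count_eq (hg : IsLinearGrowthRate g C)
    (hY : ∀ i, IsUnitPoissonProcess μ (Y i)) (hind : iIndepFun (fun i ω t => Y i t ω) μ)
    (hA : ∀ᵐ ω ∂μ, IsClock g (fun j a => Y j a.toNNReal ω) T (A ω)) {t : ℝ} (ht : t ∈ Icc 0 T)
    (i : ι) : ∫ ω, (Y i (A ω t i).toNNReal ω : ℝ) ∂μ =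
      ∫ s in 0..t, ∫ ω, g i s (fun j => Y j (A ω s j).toNNReal ω) ∂μ := by
  have hT : 0 ≤ T := ht.1.trans ht.2
  have hsub : Ioc 0 t ⊆ Icc 0 T := fun s hs => ⟨hs.1.le, hs.2.trans ht.2⟩
  have hint : Integrable (fun p : ℝ × Ω => g i p.1 (fun j => Y j (A p.2 p.1 j).toNNReal p.2))
      ((volume.restrict (Ioc 0 t)).prod μ) :=
    (hg.integrable_rate_prod hY hind hT hA i).mono_measure
      (Measure.prod_mono (Measure.restrict_mono hsub le_rfl) le_rfl)
  have hAnn : 0 ≤ᵐ[μ] fun ω => A ω t i := hA.mono fun ω hω => hω.nonneg hg.nonneg ht i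
  have hAm : AEMeasurable (fun ω => A ω t i) μ := by
    refine (hg.aemeasurable_clock hY hA ht i).coe_nnreal_real.congr ?_
    filter_upwards [hAnn] with ω hω
    exact Real.coe_toNNReal _ hω
  have h1 : ∫ ω, (Y i (A ω t i).toNNReal ω : ℝ) ∂μ = ∫ ω, A ω t i ∂μ := by
    rw [integral_eq_lintegral_of_nonneg_ae (ae_of_all _ fun ω => by positivity)
      (hg.integrable_count hY hind hA ht i).aestronglyMeasurable,
      integral_eq_lintegral_of_nonneg_ae hAnn hAm.aestronglyMeasurable]
    simp only [ENNReal.ofReal_natCast]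
    rw [hg.lintegral_clock_eq hY hind hA ht i]
  have h2 : ∫ ω, A ω t i ∂μ =
      ∫ ω, (∫ s in Ioc 0 t, g i s (fun j => Y j (A ω s j).toNNReal ω)) ∂μ := by
    refine integral_congr_ae ?_
    filter_upwards [hA] with ω hω
    rw [hω.eq t ht i, intervalIntegral.integral_of_le ht.1]
  rw [h1, h2, intervalIntegral.integral_of_le ht.1]
  exact (integral_integral_swap hint).symm

end Fubini

/-! ### Bounds for the affine rates -/

section Affine

variable {d k : ℕ} {T : ℝ}

lemma IsConstOrLinear.exists_clm {g : EuclideanSpace ℝ (Fin d) → ℝ} (hg : IsConstOrLinear g) :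
    ∃ L : EuclideanSpace ℝ (Fin d) →L[ℝ] ℝ, ∀ x, g x = g 0 + L x := by
  rcases hg with ⟨c, hc⟩ | ⟨a, ha⟩
  · exact ⟨0, fun x => by simp [hc]⟩
  · exact ⟨∑ j, a j • EuclideanSpace.proj j, fun x => by simp [ha]⟩

/-- The rates are affine in the state, with coefficients that are bounded over `[0, T]`. -/
lemma exists_affine_bound {f : Fin k → ℝ → EuclideanSpace ℝ (Fin d) → ℝ}
    (hf_cont : ∀ i, ContinuousOn (fun p : ℝ × EuclideanSpace ℝ (Fin d) => f i p.1 p.2)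
      (Icc 0 T ×ˢ univ))
    (hf_lin : ∀ i, ∀ t ∈ Icc 0 T, IsConstOrLinear (f i t)) :
    ∃ M : ℝ≥0, ∀ i, ∀ t ∈ Icc 0 T, |f i t 0| ≤ M ∧
      ∃ L : EuclideanSpace ℝ (Fin d) →L[ℝ] ℝ, ‖L‖ ≤ M ∧ ∀ x, f i t x = f i t 0 + L x := by
  have h1 : ∀ i, ∃ B : ℝ, ∀ t ∈ Icc 0 T, ∀ x ∈ Metric.closedBall 0 1, |f i t x| ≤ B := by
    intro i
    have hc : IsCompact (Icc 0 T ×ˢ Metric.closedBall (0 : EuclideanSpace ℝ (Fin d)) 1) :=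
      isCompact_Icc.prod (isCompact_closedBall _ _)
    obtain ⟨B, hB⟩ := hc.exists_bound_of_continuousOn
      ((hf_cont i).mono (prod_mono_right (subset_univ _)))
    exact ⟨B, fun t ht x hx => hB (t, x) ⟨ht, hx⟩⟩
  choose B hB using h1
  let M : ℝ := ∑ i, |B i|
  have hM : 0 ≤ M := Finset.sum_nonneg fun i _ => abs_nonneg _
  have hBM : ∀ i, B i ≤ M := fun i => (le_abs_self _).trans
    (Finset.single_le_sum (f := fun i => |B i|) (fun _ _ => abs_nonneg _) (Finset.mem_univ i))
  -- `M` bounds the rates on the closed unit ball; on unit vectors `L x = f i t x - f i t 0`, hence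
  -- the factor 2.
  refine ⟨(2 * M).toNNReal, fun i t ht => ?_⟩
  rw [Real.coe_toNNReal _ (by positivity)]
  have h0 : |f i t 0| ≤ M := (hB i t ht 0 (by simp)).trans (hBM i)
  refine ⟨by linarith, ?_⟩
  obtain ⟨L, hL⟩ := (hf_lin i t ht).exists_clm
  refine ⟨L, L.opNorm_le_of_unit_norm (by positivity) fun x hx => ?_, hL⟩
  have h2 : |f i t x| ≤ M := (hB i t ht x (by simp [hx])).trans (hBM i)
  rw [show L x = f i t x - f i t 0 by rw [hL x]; ring, Real.norm_eq_abs]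
  exact (abs_sub _ _).trans (by linarith)

/-- The rates as functions of the numbers of events. -/
noncomputable def queueRate (T : ℝ) (x₀ : EuclideanSpace ℝ (Fin d)) (l : Fin k → Fin d → ℤ)
    (f : Fin k → ℝ → EuclideanSpace ℝ (Fin d) → ℝ) (i : Fin k) (s : ℝ) (c : Fin k → ℕ) : ℝ :=
  max 0 (f i (max 0 (min s T)) (x₀ + ∑ j, (c j : ℝ) • jump (l j)))

/-- The original rates are controlled only for times in `[0, T]` and nonnegative only along the
paths. The clamped time and positive part in `queueRate` make the bounds valid for all times and
counts, including unreachable ones. -/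
lemma exists_isLinearGrowthRate {f : Fin k → ℝ → EuclideanSpace ℝ (Fin d) → ℝ} (hT : 0 ≤ T)
    (hf_cont : ∀ i, ContinuousOn (fun p : ℝ × EuclideanSpace ℝ (Fin d) => f i p.1 p.2)
      (Icc 0 T ×ˢ univ))
    (hf_lin : ∀ i, ∀ t ∈ Icc 0 T, IsConstOrLinear (f i t))
    (x₀ : EuclideanSpace ℝ (Fin d)) (l : Fin k → Fin d → ℤ) :
    ∃ C : ℝ≥0, IsLinearGrowthRate (queueRate T x₀ l f) C := by
  have hclamp : ∀ s, max 0 (min s T) ∈ Icc 0 T := fun s =>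
    ⟨le_max_left _ _, max_le hT (min_le_right _ _)⟩
  obtain ⟨M, hM⟩ := exists_affine_bound hf_cont hf_lin
  let J : ℝ≥0 := ∑ j, ‖jump (l j)‖₊
  refine ⟨M + M * (‖x₀‖₊ + J), ⟨fun i => ?_, fun i s c => le_max_left _ _, fun i s c => ?_⟩⟩
  -- There are countably many count vectors, so measurability in time for each of them suffices.
  · refine measurable_from_prod_countable_left fun c => ?_
    have : Continuous fun s => f i (max 0 (min s T)) (x₀ + ∑ j, (c j : ℝ) • jump (l j)) :=
      (hf_cont i).comp_continuous
        (f := fun s => (max 0 (min s T), x₀ + ∑ j, (c j : ℝ) • jump (l j))) (by fun_prop)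
        fun s => ⟨hclamp s, mem_univ _⟩
    exact (continuous_const.max this).measurable
  · obtain ⟨h0, L, hL, hfL⟩ := hM i _ (hclamp s)
    refine max_le (by positivity) ?_
    have hx : ‖x₀ + ∑ j, (c j : ℝ) • jump (l j)‖ ≤ ‖x₀‖ + J * ∑ j, (c j : ℝ) := by
      refine (norm_add_le _ _).trans ?_
      gcongr
      refine (norm_sum_le _ _).trans ?_
      rw [Finset.mul_sum]
      refine Finset.sum_le_sum fun j _ => ?_
      rw [norm_smul, Real.norm_natCast, mul_comm]
      gcongr
      exact_mod_cast Finset.single_le_sum (f := fun j => ‖jump (l j)‖₊) (fun _ _ => zero_le)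
        (Finset.mem_univ j)
    rw [hfL]
    have h1 := (le_abs_self _).trans (L.le_of_opNorm_le hL (x₀ + ∑ j, (c j : ℝ) • jump (l j)))
    have h2 := (le_abs_self _).trans h0
    have hS : 0 ≤ ∑ j, (c j : ℝ) := Finset.sum_nonneg fun _ _ => Nat.cast_nonneg _
    have h3 : (M : ℝ) * ‖x₀ + ∑ j, (c j : ℝ) • jump (l j)‖ ≤ M * (‖x₀‖ + J * ∑ j, (c j : ℝ)) := by
      gcongr
    push_cast
    have h4 : 0 ≤ (M : ℝ) * ∑ j, (c j : ℝ) := by positivity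
    have h5 : 0 ≤ (M : ℝ) * ‖x₀‖ * ∑ j, (c j : ℝ) := by positivity
    have h6 : 0 ≤ (M : ℝ) * J := by positivity
    nlinarith

end Affine

/-! ### Uniqueness of the fluid model -/

section Fluid

variable {d k : ℕ} {T : ℝ} {x₀ : EuclideanSpace ℝ (Fin d)} {l : Fin k → Fin d → ℤ}
  {f : Fin k → ℝ → EuclideanSpace ℝ (Fin d) → ℝ}

/-- The fluid model is unique when the rates are Lipschitz in the state. -/
theorem IsFluidModel.unique {x y : ℝ → EuclideanSpace ℝ (Fin d)} (hx : IsFluidModel T x₀ l f x)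
    (hy : IsFluidModel T x₀ l f y) {M : ℝ≥0}
    (hM : ∀ i, ∀ t ∈ Icc 0 T, LipschitzWith M (f i t)) : EqOn x y (Icc 0 T) := by
  intro t₀ ht₀
  have hT : 0 ≤ T := ht₀.1.trans ht₀.2
  let h : Fin k → ℝ → ℝ := fun i s => f i s (x s) - f i s (y s)
  have hint : ∀ i, IntegrableOn (h i) (Ioc 0 T) := fun i =>
    (intervalIntegrable_iff_integrableOn_Ioc_of_le hT).1
      ((hx.rate_integrable i).sub (hy.rate_integrable i))
  have hdiff : ∀ t ∈ Icc 0 T, x t - y t = ∑ i, (∫ s in Ioc 0 t, h i s) • jump (l i) := by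
    intro t ht
    have hmem : uIcc 0 t ⊆ uIcc 0 T := by
      rw [uIcc_of_le ht.1, uIcc_of_le hT]; exact Icc_subset_Icc_right ht.2
    rw [hx.equation t ht, hy.equation t ht, add_sub_add_left_eq_sub, ← Finset.sum_sub_distrib]
    refine Finset.sum_congr rfl fun i _ => ?_
    rw [← sub_smul, ← intervalIntegral.integral_sub ((hx.rate_integrable i).mono_set hmem)
      ((hy.rate_integrable i).mono_set hmem), intervalIntegral.integral_of_le ht.1]
  let J : ℝ≥0 := ∑ i, ‖jump (l i)‖₊
  have hbound : ∀ t ∈ Icc 0 T, ‖x t - y t‖ₑ ≤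
      ∑ i, (∫⁻ s in Ioc 0 t, ‖h i s‖ₑ) * ‖jump (l i)‖ₑ := by
    intro t ht
    rw [hdiff t ht]
    refine (enorm_sum_le _ _).trans (Finset.sum_le_sum fun i _ => ?_)
    rw [enorm_smul]
    gcongr
    exact enorm_integral_le_lintegral_enorm _
  -- With `a = 0` the conclusion says that the difference vanishes; integrability of the rates
  -- supplies the finite a priori bound.
  have hgron := lintegral_gronwall (φ := fun t => ‖x t - y t‖ₑ) (T := T) (a := 0)
    (M := ∑ i, (∫⁻ s in Ioc 0 T, ‖h i s‖ₑ) * ‖jump (l i)‖ₑ) (K := M * J) ?_ ?_ ?_ t₀ ht₀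
  · simp only [mul_zero, zero_mul, nonpos_iff_eq_zero, enorm_eq_zero, sub_eq_zero] at hgron
    exact hgron
  · exact (ENNReal.sum_lt_top.2 fun i _ => ENNReal.mul_lt_top (hint i).2 enorm_lt_top).ne
  · intro t ht
    refine (hbound t ht).trans ?_
    gcongr
    exact ht.2
  · intro t ht
    refine (hbound t ht).trans ?_
    rw [zero_add]
    calc ∑ i, (∫⁻ s in Ioc 0 t, ‖h i s‖ₑ) * ‖jump (l i)‖ₑ
        ≤ ∑ i, (∫⁻ s in Ioc 0 t, M * ‖x s - y s‖ₑ) * ‖jump (l i)‖ₑ := by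
          refine Finset.sum_le_sum fun i _ => mul_le_mul_left ?_ _
          refine setLIntegral_mono' measurableSet_Ioc fun s hs => ?_
          have := hM i s ⟨hs.1.le, hs.2.trans ht.2⟩ (x s) (y s)
          rwa [edist_eq_enorm_sub, edist_eq_enorm_sub] at this
      _ = ∫⁻ s in Ioc 0 t, (M * J : ℝ≥0) * ‖x s - y s‖ₑ := by
          rw [← Finset.mul_sum, lintegral_const_mul' _ _ ENNReal.coe_ne_top,
            lintegral_const_mul' _ _ ENNReal.coe_ne_top]
          simp only [J, ENNReal.coe_mul, ENNReal.ofNNReal_finsetSum, enorm_eq_nnnorm]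
          ring

end Fluid

/-! ### The queue: its clocks and its mean -/

section Queue

variable {Ω : Type*} [MeasurableSpace Ω] {μ : Measure Ω} {d k : ℕ} {T : ℝ}
  {x₀ : EuclideanSpace ℝ (Fin d)} {l : Fin k → Fin d → ℤ}
  {f : Fin k → ℝ → EuclideanSpace ℝ (Fin d) → ℝ} {Y : Fin k → ℝ≥0 → Ω → ℕ}
  {X : ℝ → Ω → EuclideanSpace ℝ (Fin d)}

/-- Along the paths of the queue, the rates are functions of the numbers of events. -/
lemma IsQueueProcess.queueRate_eq (hX : IsQueueProcess μ T x₀ l f Y X) :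
    ∀ᵐ ω ∂μ, ∀ s ∈ Icc 0 T, ∀ i, queueRate T x₀ l f i s
      (fun j => Y j (∫ r in 0..s, f j r (X r ω)).toNNReal ω) = f i s (X s ω) := by
  filter_upwards [hX.rate_nonneg, hX.equation] with ω hnn heq s hs i
  -- Along the actual path both the clamp and the positive part are inactive.
  rw [queueRate, min_eq_left hs.2, max_eq_right hs.1, ← heq s hs, max_eq_right (hnn i s hs)]

lemma IsQueueProcess.isClock (hX : IsQueueProcess μ T x₀ l f Y X) (hT : 0 ≤ T) :
    ∀ᵐ ω ∂μ, IsClock (queueRate T x₀ l f) (fun j a => Y j a.toNNReal ω) T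
      (fun s j => ∫ r in 0..s, f j r (X r ω)) := by
  filter_upwards [hX.rate_integrable, hX.queueRate_eq] with ω hint hrate
  refine ⟨fun i => (hint i).congr fun s hs => ?_, fun r hr i => ?_⟩
  · rw [uIoc_of_le hT] at hs
    exact (hrate s ⟨hs.1.le, hs.2⟩ i).symm
  · refine intervalIntegral.integral_congr fun s hs => ?_
    rw [uIcc_of_le hr.1] at hs
    exact (hrate s ⟨hs.1, hs.2.trans hr.2⟩ i).symm

lemma IsQueueProcess.integrable [IsProbabilityMeasure μ] (hX : IsQueueProcess μ T x₀ l f Y X)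
    {C : ℝ≥0} (hg : IsLinearGrowthRate (queueRate T x₀ l f) C)
    (hY : ∀ i, IsUnitPoissonProcess μ (Y i)) (hind : iIndepFun (fun i ω t => Y i t ω) μ) {t : ℝ}
    (ht : t ∈ Icc 0 T) : Integrable (X t) μ := by
  have h1 := fun i => (hg.integrable_count hY hind (hX.isClock (ht.1.trans ht.2)) ht i).smul_const
    (jump (l i))
  refine ((integrable_const x₀).add (integrable_finsetSum Finset.univ fun i _ => h1 i)).congr ?_
  filter_upwards [hX.equation] with ω hω
  rw [hω t ht]
  simp

/-- The only place where the affine form yields exactness: the mean of the rate is the rate at the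
mean state. Inserting this into the time-integral formula for the mean counts gives the fluid
equation. -/
theorem IsQueueProcess.isFluidModel_integral [IsProbabilityMeasure μ]
    (hX : IsQueueProcess μ T x₀ l f Y X)
    {C : ℝ≥0} (hg : IsLinearGrowthRate (queueRate T x₀ l f) C)
    (hf_lin : ∀ i, ∀ t ∈ Icc 0 T, IsConstOrLinear (f i t))
    (hY : ∀ i, IsUnitPoissonProcess μ (Y i)) (hind : iIndepFun (fun i ω t => Y i t ω) μ)
    (hT : 0 ≤ T) : IsFluidModel T x₀ l f (fun t => ∫ ω, X t ω ∂μ) := by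
  have hA := hX.isClock hT
  have hmean : ∀ s ∈ Icc 0 T, ∀ i, ∫ ω, queueRate T x₀ l f i s
      (fun j => Y j (∫ r in 0..s, f j r (X r ω)).toNNReal ω) ∂μ = f i s (∫ ω, X s ω ∂μ) := by
    intro s hs i
    obtain ⟨L, hL⟩ := (hf_lin i s hs).exists_clm
    have h1 : ∀ᵐ ω ∂μ, queueRate T x₀ l f i s
        (fun j => Y j (∫ r in 0..s, f j r (X r ω)).toNNReal ω) = f i s 0 + L (X s ω) := by
      filter_upwards [hX.queueRate_eq] with ω hω
      rw [hω s hs i, hL]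
    have hXs := hX.integrable hg hY hind hs
    rw [integral_congr_ae h1, integral_add (integrable_const _) (L.integrable_comp hXs),
      L.integral_comp_comm hXs, hL (∫ ω, X s ω ∂μ)]
    simp
  refine ⟨fun i => ?_, fun t ht => ?_⟩
  · refine (hg.intervalIntegrable_mean_rate hY hind hT hA i).congr fun s hs => ?_
    rw [uIoc_of_le hT] at hs
    exact hmean s ⟨hs.1.le, hs.2⟩ i
  · have h1 : ∀ᵐ ω ∂μ, X t ω = x₀ + ∑ i,
        (Y i (∫ r in 0..t, f i r (X r ω)).toNNReal ω : ℝ) • jump (l i) := by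
      filter_upwards [hX.equation] with ω hω using hω t ht
    have hN := fun i => hg.integrable_count hY hind hA ht i
    rw [integral_congr_ae h1, integral_add (integrable_const _)
      (integrable_finsetSum Finset.univ fun i _ => (hN i).smul_const _),
      integral_finsetSum _ fun i _ => (hN i).smul_const _]
    simp only [integral_const, probReal_univ, one_smul]
    congr 1
    refine Finset.sum_congr rfl fun i _ => ?_
    rw [integral_smul_const, hg.integral_count_eq hY hind hA ht i]
    congr 1
    refine intervalIntegral.integral_congr fun s hs => ?_
    rw [uIcc_of_le ht.1] at hs
    exact hmean s ⟨hs.1, hs.2.trans ht.2⟩ i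

end Queue

end StateDependentQueue

theorem corollary2 {Ω : Type*} [MeasurableSpace Ω] (μ : Measure Ω) [IsProbabilityMeasure μ]
    {d k : ℕ} (T : ℝ) (x₀ : EuclideanSpace ℝ (Fin d)) (l : Fin k → Fin d → ℤ)
    (f : Fin k → ℝ → EuclideanSpace ℝ (Fin d) → ℝ)
    (hf_cont : ∀ i, ContinuousOn (fun p : ℝ × EuclideanSpace ℝ (Fin d) => f i p.1 p.2)
      (Icc 0 T ×ˢ univ))
    (hf_lin : ∀ i, ∀ t ∈ Icc 0 T, StateDependentQueue.IsConstOrLinear (f i t))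
    (Y : Fin k → ℝ≥0 → Ω → ℕ)
    (hY : ∀ i, StateDependentQueue.IsUnitPoissonProcess μ (Y i))
    (hY_indep : iIndepFun (fun i ω t => Y i t ω) μ)
    (X : ℝ → Ω → EuclideanSpace ℝ (Fin d))
    (hX : StateDependentQueue.IsQueueProcess μ T x₀ l f Y X)
    (xbar : ℝ → EuclideanSpace ℝ (Fin d))
    (hxbar : StateDependentQueue.IsFluidModel T x₀ l f xbar) :
    ∀ t ∈ Icc 0 T, Integrable (X t) μ ∧ ∫ ω, X t ω ∂μ = xbar t := by
  intro t ht
  have hT : 0 ≤ T := ht.1.trans ht.2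
  obtain ⟨C, hg⟩ := StateDependentQueue.exists_isLinearGrowthRate hT hf_cont hf_lin x₀ l
  obtain ⟨M, hM⟩ := StateDependentQueue.exists_affine_bound hf_cont hf_lin
  refine ⟨hX.integrable hg hY hY_indep ht, ?_⟩
  refine (hX.isFluidModel_integral hg hf_lin hY hY_indep hT).unique hxbar (M := M) ?_ ht
  intro i s hs
  obtain ⟨-, L, hL, hfL⟩ := hM i s hs
  refine LipschitzWith.of_dist_le_mul fun x y => ?_
  rw [hfL x, hfL y, dist_add_left, dist_eq_norm, dist_eq_norm, ← map_sub]
  exact L.le_of_opNorm_le hL _
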